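/- Setting. There are $\ell$ servers of capacity $k$ and a set $V$ of $n$ processes. An initial configuration $\mathcal I$ assigns the processes to the servers so that every server holds at most $k$ of them (in particular $n\le \ell k$). A request sequence $\sigma=(\sigma_1,\dots,\sigma_T)$ consists of pairs $\sigma_t=\{p,q\}$ with $p,q\in V$. A solution for $\sigma$ is a sequence of configurations $x_0=\mathcal I,x_1,\dots,x_T$; its cost is the sum over $t=1,\dots,T$ of the number of processes whose servers in $x_{t-1}$ and $x_t$ differ (migration cost) plus $1$ if the two processes of $\sigma_t$ are on different servers in $x_t$ (communication cost). $\mathrm{OPT}(\sigma)$, the cost of an optimal dynamic offline algorithm, is the minimum cost of a solution in which every $x_t$ has at most $k$ processes on every server. In the generalized learning problem the request sequences are those for which some static assignment of the processes to the servers, with at most $k$ processes on every server, puts the two processes of each request on the same server. A deterministic online algorithm determines $x_t$ from $\sigma_1,\dots,\sigma_t$ alone (it knows $k$, $\ell$, $V$ and $\mathcal I$); it has augmentation $\alpha$ if every $x_t$ has at most $\alpha k$ processes on every server, and $\mathrm{ALG}(\sigma)$ denotes the cost of its solution for $\sigma$. Theorem. For every $\varepsilon>0$ there is a constant $C>0$,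 depending only on $\varepsilon$, such that for all $k,\ell,n$ and every initial configuration $\mathcal I$ as above there is a deterministic online algorithm for the generalized learning problem with augmentation $2+\varepsilon$ and with $$\mathrm{ALG}(\sigma)\le C\sqrt{k}\cdot\mathrm{OPT}(\sigma)$$ for every request sequence $\sigma$ of the generalized learning problem. -/

import Mathlib

namespace BalancedPartitioning

/-- A configuration (scheduling): an assignment of the processes `V` to the servers `S`. -/
abbrev Config (V S : Type*) := V → S

section Model

variable {V S : Type*} [Fintype V] [DecidableEq S]

/-- The number of processes that a configuration places on server `s`. -/
def load (c : Config V S) (s : S) : ℕ :=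
  (Finset.univ.filter fun p => c p = s).card

/-- The migration cost of passing from `c` to `c'`: each process that changes its server costs `1`. -/
def migrationCost (c c' : Config V S) : ℕ :=
  (Finset.univ.filter fun p => c p ≠ c' p).card

/-- The communication cost of a request `{p, q}`: it is `0` if `p` and `q` are on the same server
and `1` otherwise. -/
def communicationCost (c : Config V S) (r : Sym2 V) : ℕ :=
  if (Sym2.map c r).IsDiag then 0 else 1

/-- The total cost of serving the requests `σ` when `x 0` is the configuration at the start and
`x (t + 1)` is the configuration in which the request number `t` (counted from `0`) is served. The
migrations from `x t` to `x (t + 1)` take place before that request is served. -/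
def cost (x : ℕ → Config V S) (σ : List (Sym2 V)) : ℕ :=
  ∑ t : Fin σ.length, (migrationCost (x t) (x (t + 1)) + communicationCost (x (t + 1)) (σ.get t))

/-- A feasible solution of a dynamic offline algorithm for `σ`: it starts in the initial
configuration `home` and has at most `k` processes on every server at every time. -/
def IsFeasible (k : ℕ) (home : Config V S) (σ : List (Sym2 V)) (x : ℕ → Config V S) : Prop :=
  x 0 = home ∧ ∀ t ≤ σ.length, ∀ s, load (x t) s ≤ k

/-- `OPT(σ)`, the optimum cost of a dynamic offline algorithm on `σ`. -/
noncomputable def opt (k : ℕ) (home : Config V S) (σ : List (Sym2 V)) : ℕ :=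
  sInf {m | ∃ x : ℕ → Config V S, IsFeasible k home σ x ∧ cost x σ = m}

/-- If the initial configuration obeys the capacities, then the infimum in the definition of `opt`
is a minimum. -/
theorem opt_isLeast (k : ℕ) (home : Config V S) (hk : ∀ s, load home s ≤ k)
    (σ : List (Sym2 V)) :
    IsLeast {m | ∃ x : ℕ → Config V S, IsFeasible k home σ x ∧ cost x σ = m} (opt k home σ) := by
  have hne : {m | ∃ x : ℕ → Config V S, IsFeasible k home σ x ∧ cost x σ = m}.Nonempty :=
    ⟨_, fun _ => home, ⟨rfl, fun _ _ => hk⟩, rfl⟩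
  exact ⟨Nat.sInf_mem hne, fun _ hm => Nat.sInf_le hm⟩

/-- The restriction on the request sequence in the learning model: there is a static placement of
the processes, with at most `k` of them on every server, under which no request of `σ`
communicates across servers. -/
def Learnable (S : Type*) [DecidableEq S] (k : ℕ) (σ : List (Sym2 V)) : Prop :=
  ∃ g : Config V S, (∀ s, load g s ≤ k) ∧ ∀ r ∈ σ, communicationCost g r = 0

end Model

/-- A deterministic online algorithm that starts in the initial configuration `home`: after the
requests of the list `τ` have been revealed (and nothing else), the last request of `τ` is served
in the configuration `config τ`. -/
structure OnlineAlgorithm {V S : Type*} (home : Config V S) where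
  config : List (Sym2 V) → Config V S
  config_nil : config [] = home

namespace OnlineAlgorithm

variable {V S : Type*} [Fintype V] [DecidableEq S] {home : Config V S}

/-- The configurations of the algorithm on `σ` over time. -/
def run (A : OnlineAlgorithm home) (σ : List (Sym2 V)) (t : ℕ) : Config V S :=
  A.config (σ.take t)

/-- The algorithm uses resource augmentation `α`: on the request sequences of the learning model
it never has more than `α * k` processes on a server. -/
def HasAugmentation (A : OnlineAlgorithm home) (k : ℕ) (α : ℝ) : Prop :=
  ∀ σ : List (Sym2 V), Learnable S k σ →
    ∀ t ≤ σ.length, ∀ s, (load (A.run σ t) s : ℝ) ≤ α * k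

/-- The algorithm is (strictly) `ρ`-competitive against the dynamic offline optimum, on the request
sequences of the learning model. -/
def IsCompetitive (A : OnlineAlgorithm home) (k : ℕ) (ρ : ℝ) : Prop :=
  ∀ σ : List (Sym2 V), Learnable S k σ →
    (cost (A.run σ) σ : ℝ) ≤ ρ * (opt k home σ : ℝ)

end OnlineAlgorithm

end BalancedPartitioning

/-! Let D be about √k. The algorithm tracks the connected components of the requests; for a
learnable sequence each has at most k processes. A process whose charge is below D is labelled by
itself. A tight process (charge at least D) has the label it voted for, copied from a partner in a
request. A conflict is a request inside a component whose ends have labels u, u' with different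
homes. Then u and u' are each charged m + 1, where m < D is the number of tight processes of the
component, and its votes are dropped.

Placement: in each component the voters for a server s go where the residents (processes that are
not tight, with home s) go: to s if the residents reach `threshold` of the voters, else into the
blob of the component. Undecided tight processes are in the blob, and a component with D tight
processes lies in it entirely. So each server holds at most 2k processes outside blobs
(`LearnState.card_not_gathered_le`). Blobs have size at most k and can be moved as wholes from
servers above (2+ε)k; clearing down to 2k is paid for by the excess over 2k (`exists_rebalance`).

All other cost is bounded by a potential (`LearnState.cost_step`), which is at most a constant times
the total charge, because D tight processes carry charge D² ≥ k (`LearnState.potential_le`).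

The total charge is O(D · OPT) (`LearnState.Accounts`). If the offline solution has spent nothing in
a component since its last conflict, a label u of v tells the truth: v is at the home of u, unless u
has been moved. The ends of a conflict are then together, so u or u' has been moved, and half of the
new charge lies on a moved process, which never reaches charge 2D. Otherwise the conflict, of total
charge at most 2D, is paid for by the offline cost in the component. -/

namespace BalancedPartitioning

/-! ### Loads, averaging and the excess over 2k. -/

section Loads

variable {V S : Type*} [Fintype V] [DecidableEq S]

theorem migrationCost_self (c : Config V S) : migrationCost c c = 0 := by
  simp [migrationCost]

theorem migrationCost_triangle (c₁ c₂ c₃ : Config V S) :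
    migrationCost c₁ c₃ ≤ migrationCost c₁ c₂ + migrationCost c₂ c₃ := by
  classical
  unfold migrationCost
  refine le_trans (Finset.card_le_card ?_) (Finset.card_union_le _ _)
  intro v hv
  simp only [Finset.mem_filter, Finset.mem_univ, true_and, Finset.mem_union] at hv ⊢
  by_contra! h
  exact hv (h.1.trans h.2)

variable [Fintype S]

theorem sum_load (c : Config V S) : ∑ s, load c s = Fintype.card V := by
  unfold load
  rw [← Finset.card_univ]
  exact (Finset.card_eq_sum_card_fiberwise fun v _ => Finset.mem_univ (c v)).symm

theorem card_le_of_load_le {c : Config V S} {k : ℕ} (h : ∀ s, load c s ≤ k) :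
    Fintype.card V ≤ k * Fintype.card S := by
  rw [← sum_load c]
  calc ∑ s, load c s ≤ ∑ _s : S, k := Finset.sum_le_sum fun s _ => h s
    _ = k * Fintype.card S := by simp [mul_comm]

theorem exists_load_le {k : ℕ} [Nonempty S] (hn : Fintype.card V ≤ k * Fintype.card S)
    (c : Config V S) : ∃ s, load c s ≤ k := by
  by_contra! h
  have : ∑ _s : S, k < ∑ s, load c s :=
    Finset.sum_lt_sum_of_nonempty Finset.univ_nonempty fun s _ => h s
  rw [sum_load] at this
  simp only [Finset.sum_const, Finset.card_univ, smul_eq_mul] at this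
  rw [mul_comm] at this
  omega

/-- The total amount by which the loads exceed `2 * k`. -/
def excess (k : ℕ) (c : Config V S) : ℕ := ∑ s, (load c s - 2 * k)

/-- Only arrivals raise the excess of a server, each by at most one. -/
theorem excess_le_add_migrationCost (k : ℕ) (c c' : Config V S) :
    excess k c' ≤ excess k c + migrationCost c c' := by
  classical
  have hm : migrationCost c c' =
      ∑ s, (Finset.univ.filter fun v => c v ≠ c' v ∧ c' v = s).card := by
    unfold migrationCost
    rw [Finset.card_eq_sum_card_fiberwise (f := c') (t := Finset.univ)
      fun v _ => Finset.mem_univ (c' v)]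
    simp only [Finset.filter_filter]
  rw [hm, excess, excess, ← Finset.sum_add_distrib]
  refine Finset.sum_le_sum fun s _ => ?_
  have : load c' s ≤ load c s + (Finset.univ.filter fun v => c v ≠ c' v ∧ c' v = s).card := by
    unfold load
    refine le_trans (Finset.card_le_card ?_) (Finset.card_union_le _ _)
    intro v hv
    simp only [Finset.mem_filter, Finset.mem_univ, true_and, Finset.mem_union] at hv ⊢
    by_cases h : c v = s
    · exact Or.inl h
    · exact Or.inr ⟨fun h' => h (h'.trans hv), hv⟩
  omega

end Loads

/-! ### Rebalancing servers by moving whole blobs. -/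

section Blobs

variable {V S R : Type*} [Fintype V] [Fintype S] [DecidableEq S]

open Classical in
/-- The configuration in which the processes satisfying `G` are gathered in blobs, the blob with
name `r` being placed on server `β r`, and the other processes are placed by `base`. -/
noncomputable def blobConfig (G : V → Prop) (rep : V → R) (base : V → S) (β : R → S) :
    Config V S :=
  fun v => if G v then β (rep v) else base v

variable {G : V → Prop} {rep : V → R} {base : V → S} {k : ℕ}

-- Blobs leave `s` one at a time. While its load exceeds 2k, `hbase` yields a nonempty blob on `s`,
-- and by averaging some server of load at most k can take it without exceeding 2k. The moved
-- processes and those remaining were all on `s` before, whence the last inequality.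
open Classical in
theorem exists_relieve (hn : Fintype.card V ≤ k * Fintype.card S)
    (hblob : ∀ r, (Finset.univ.filter fun v => G v ∧ rep v = r).card ≤ k)
    (hbase : ∀ s, (Finset.univ.filter fun v => ¬ G v ∧ base v = s).card ≤ 2 * k) (s : S)
    (β : R → S) :
    ∃ β' : R → S, load (blobConfig G rep base β') s ≤ 2 * k ∧
      (∀ u, u ≠ s → load (blobConfig G rep base β') u ≤
        max (load (blobConfig G rep base β) u) (2 * k)) ∧
      migrationCost (blobConfig G rep base β) (blobConfig G rep base β') +
        load (blobConfig G rep base β') s ≤ load (blobConfig G rep base β) s := by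
  have : Nonempty S := ⟨s⟩
  induction hN : load (blobConfig G rep base β) s using Nat.strong_induction_on generalizing β with
  | _ N ih =>
  subst hN
  by_cases hle : load (blobConfig G rep base β) s ≤ 2 * k
  · exact ⟨β, hle, fun u _ => le_max_left _ _, by simp [migrationCost_self]⟩
  push Not at hle
  obtain ⟨v₀, hG, hv₀⟩ : ∃ v, G v ∧ β (rep v) = s := by
    by_contra! h
    refine absurd (hbase s) (not_le.2 (lt_of_lt_of_le hle ?_))
    refine Finset.card_le_card fun v hv => ?_
    simp only [Finset.mem_filter, Finset.mem_univ, true_and] at hv ⊢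
    unfold blobConfig at hv
    by_cases hG : G v
    · rw [if_pos hG] at hv
      exact absurd hv (h v hG)
    · rw [if_neg hG] at hv
      exact ⟨hG, hv⟩
  obtain ⟨t, ht⟩ := exists_load_le hn (blobConfig G rep base β)
  have hts : t ≠ s := by
    rintro rfl
    omega
  set β₁ : R → S := Function.update β (rep v₀) t with hβ₁
  set B := Finset.univ.filter fun v => G v ∧ rep v = rep v₀ with hB
  have hB1 : 1 ≤ B.card := Finset.card_pos.2 ⟨v₀, by simp [hB, hG]⟩
  have hBk : B.card ≤ k := hblob _
  have hc : ∀ v, blobConfig G rep base β₁ v =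
      if v ∈ B then t else blobConfig G rep base β v := by
    intro v
    simp only [blobConfig, hβ₁, hB, Finset.mem_filter, Finset.mem_univ, true_and,
      Function.update_apply]
    by_cases hGv : G v <;> by_cases hr : rep v = rep v₀ <;> simp [hGv, hr]
  have hcB : ∀ v ∈ B, blobConfig G rep base β v = s := by
    intro v hv
    simp only [hB, Finset.mem_filter, Finset.mem_univ, true_and] at hv
    simp [blobConfig, hv.1, hv.2, hv₀]
  have hs : load (blobConfig G rep base β₁) s + B.card ≤ load (blobConfig G rep base β) s := by
    unfold load
    rw [← Finset.card_union_of_disjoint]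
    · refine Finset.card_le_card fun v hv => ?_
      simp only [Finset.mem_union, Finset.mem_filter, Finset.mem_univ, true_and, hc] at hv ⊢
      rcases hv with hv | hv
      · by_cases hvB : v ∈ B
        · simp [hvB, hts] at hv
        · simpa [hvB] using hv
      · exact hcB v hv
    · rw [Finset.disjoint_left]
      intro v hv hvB
      simp [hc, hvB, hts] at hv
  have ht' : load (blobConfig G rep base β₁) t ≤ load (blobConfig G rep base β) t + B.card := by
    unfold load
    refine le_trans (Finset.card_le_card fun v hv => ?_) (Finset.card_union_le _ _)
    simp only [Finset.mem_union, Finset.mem_filter, Finset.mem_univ, true_and, hc] at hv ⊢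
    by_cases hvB : v ∈ B
    · exact Or.inr hvB
    · exact Or.inl (by simpa [hvB] using hv)
  have hu : ∀ u, u ≠ t → load (blobConfig G rep base β₁) u ≤ load (blobConfig G rep base β) u := by
    intro u hut
    unfold load
    refine Finset.card_le_card fun v hv => ?_
    simp only [Finset.mem_filter, Finset.mem_univ, true_and, hc] at hv ⊢
    by_cases hvB : v ∈ B
    · exact absurd (by simpa [hvB] using hv) hut.symm
    · simpa [hvB] using hv
  have hmig : migrationCost (blobConfig G rep base β) (blobConfig G rep base β₁) ≤ B.card := by
    unfold migrationCost
    refine Finset.card_le_card fun v hv => ?_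
    simp only [Finset.mem_filter, Finset.mem_univ, true_and, hc] at hv
    by_contra hvB
    simp [hvB] at hv
  obtain ⟨β', h1, h2, h3⟩ := ih _ (by omega) β₁ rfl
  refine ⟨β', h1, fun u hus => ?_, ?_⟩
  · refine (h2 u hus).trans (max_le ?_ (le_max_right _ _))
    by_cases hut : u = t
    · subst hut
      exact le_max_of_le_right (by omega)
    · exact le_max_of_le_left (hu u hut)
  · have := migrationCost_triangle (blobConfig G rep base β) (blobConfig G rep base β₁)
      (blobConfig G rep base β')
    omega

-- Clearing a server of load x > (2+ε)k costs at most x and lowers the excess by at least x − 2k,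
-- while x ≤ (2+ε)/ε · (x − 2k). No other server gains excess, so the process ends.
open Classical in
theorem exists_rebalance (hn : Fintype.card V ≤ k * Fintype.card S)
    (hblob : ∀ r, (Finset.univ.filter fun v => G v ∧ rep v = r).card ≤ k)
    (hbase : ∀ s, (Finset.univ.filter fun v => ¬ G v ∧ base v = s).card ≤ 2 * k)
    {ε : ℝ} (hε : 0 < ε) (β : R → S) :
    ∃ β' : R → S, (∀ s, (load (blobConfig G rep base β') s : ℝ) ≤ (2 + ε) * k) ∧
      (migrationCost (blobConfig G rep base β) (blobConfig G rep base β') : ℝ) +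
        (2 + ε) / ε * excess k (blobConfig G rep base β') ≤
        (2 + ε) / ε * excess k (blobConfig G rep base β) := by
  induction hN : excess k (blobConfig G rep base β) using Nat.strong_induction_on
    generalizing β with
  | _ N ih =>
  subst hN
  by_cases hle : ∀ s, (load (blobConfig G rep base β) s : ℝ) ≤ (2 + ε) * k
  · exact ⟨β, hle, by simp [migrationCost_self]⟩
  push Not at hle
  obtain ⟨s, hs⟩ := hle
  obtain ⟨β₁, h1, h2, h3⟩ := exists_relieve hn hblob hbase s β
  have hs2 : 2 * k < load (blobConfig G rep base β) s := by
    have : (2 * k : ℝ) < load (blobConfig G rep base β) s := by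
      have : 0 ≤ ε * k := by positivity
      nlinarith
    exact_mod_cast this
  have hex : excess k (blobConfig G rep base β₁) + (load (blobConfig G rep base β) s - 2 * k) ≤
      excess k (blobConfig G rep base β) := by
    unfold excess
    rw [← Finset.add_sum_erase _ _ (Finset.mem_univ s), ← Finset.add_sum_erase _
      (fun u => load (blobConfig G rep base β) u - 2 * k) (Finset.mem_univ s)]
    have : ∑ u ∈ Finset.univ.erase s, (load (blobConfig G rep base β₁) u - 2 * k) ≤
        ∑ u ∈ Finset.univ.erase s, (load (blobConfig G rep base β) u - 2 * k) := by
      refine Finset.sum_le_sum fun u hu => ?_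
      have := h2 u (Finset.ne_of_mem_erase hu)
      rcases le_max_iff.1 this with h | h <;> omega
    omega
  obtain ⟨β', h1', h2'⟩ := ih _ (by omega) β₁ rfl
  refine ⟨β', h1', ?_⟩
  have htri := migrationCost_triangle (blobConfig G rep base β) (blobConfig G rep base β₁)
      (blobConfig G rep base β')
  have htri' : (migrationCost (blobConfig G rep base β) (blobConfig G rep base β') : ℝ) ≤
      migrationCost (blobConfig G rep base β) (blobConfig G rep base β₁) +
      migrationCost (blobConfig G rep base β₁) (blobConfig G rep base β') := by
    exact_mod_cast htri
  have hmig : (migrationCost (blobConfig G rep base β) (blobConfig G rep base β₁) : ℝ) ≤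
      load (blobConfig G rep base β) s := by
    exact_mod_cast (by omega : _ ≤ _)
  have hexR : (excess k (blobConfig G rep base β₁) : ℝ) +
      (load (blobConfig G rep base β) s - 2 * k) ≤ excess k (blobConfig G rep base β) := by
    have h : (excess k (blobConfig G rep base β₁) : ℝ) +
      ((load (blobConfig G rep base β) s - 2 * k : ℕ) : ℝ) ≤
        excess k (blobConfig G rep base β) := by exact_mod_cast hex
    rwa [Nat.cast_sub hs2.le, Nat.cast_mul, Nat.cast_ofNat] at h
  have hkey : (load (blobConfig G rep base β) s : ℝ) ≤
      (2 + ε) / ε * (load (blobConfig G rep base β) s - 2 * k) := by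
    rw [div_mul_eq_mul_div, le_div_iff₀ hε]
    nlinarith
  have hpos : 0 ≤ (2 + ε) / ε := by positivity
  nlinarith [mul_le_mul_of_nonneg_left hexR hpos]

end Blobs

end BalancedPartitioning

/-! ### Learning state, thresholds and the credit of votes. -/

namespace BalancedPartitioning

/-- The bookkeeping of the online algorithm: representatives of the connected components of the
request graph, the charge of every process, and the process for which a process votes. -/
structure LearnState (V : Type*) where
  rep : V → V
  charge : V → ℕ
  vote : V → Option V

/-- The smallest power of two that is larger than `a`. -/
def threshold (a : ℕ) : ℕ := 2 ^ a.size

theorem lt_threshold (a : ℕ) : a < threshold a := Nat.lt_size_self a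

theorem threshold_zero : threshold 0 = 1 := by simp [threshold]

theorem threshold_le {a : ℕ} (ha : a ≠ 0) : threshold a ≤ 2 * a := by
  have hs : 0 < a.size := Nat.size_pos.2 (Nat.pos_of_ne_zero ha)
  have h : 2 ^ (a.size - 1) ≤ a := Nat.lt_size.1 (by omega)
  have : threshold a = 2 * 2 ^ (a.size - 1) := by
    rw [threshold, ← pow_succ']
    congr 1
    omega
  omega

theorem threshold_succ (a : ℕ) :
    threshold (a + 1) = threshold a ∨ threshold (a + 1) = 2 * threshold a := by
  have h1 : a.size ≤ (a + 1).size := Nat.size_le_size (Nat.le_succ a)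
  have h2 : (a + 1).size ≤ a.size + 1 := by
    rw [Nat.size_le, pow_succ]
    have := lt_threshold a
    unfold threshold at this
    omega
  rcases Nat.lt_or_ge a.size (a + 1).size with h | h
  · right
    rw [threshold, threshold, show (a + 1).size = a.size + 1 by omega, pow_succ']
  · left
    rw [threshold, threshold, show (a + 1).size = a.size by omega]

/-- An upper bound for the cost that was spent on `a` tight processes voting for a server with `c`
residents. -/
def voteCredit (a c : ℕ) : ℕ :=
  if a = 0 then 0 else if c < threshold a then a + 4 * threshold a + c else a + 7 * threshold a

theorem voteCredit_zero (c : ℕ) : voteCredit 0 c = 0 := by simp [voteCredit]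

theorem voteCredit_of_lt {a c : ℕ} (ha : a ≠ 0) (h : c < threshold a) :
    voteCredit a c = a + 4 * threshold a + c := by
  rw [voteCredit, if_neg ha, if_pos h]

theorem voteCredit_of_le {a c : ℕ} (ha : a ≠ 0) (h : threshold a ≤ c) :
    voteCredit a c = a + 7 * threshold a := by
  rw [voteCredit, if_neg ha, if_neg (not_lt.2 h)]

/-- Both branches are at most a + 7T with T = `threshold a` ≤ 2a. -/
theorem voteCredit_le (a c : ℕ) : voteCredit a c ≤ 15 * a := by
  rcases eq_or_ne a 0 with rfl | ha
  · simp [voteCredit_zero]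
  have := threshold_le ha
  rcases lt_or_ge c (threshold a) with h | h
  · rw [voteCredit_of_lt ha h]
    omega
  · rw [voteCredit_of_le ha h]
    omega

theorem voteCredit_succ_of_lt {a c : ℕ} (h : c < threshold a) :
    voteCredit a c ≤ voteCredit (a + 1) c := by
  rcases eq_or_ne a 0 with rfl | ha
  · simp [voteCredit_zero]
  have hs := threshold_succ a
  rw [voteCredit_of_lt ha h, voteCredit_of_lt (show a + 1 ≠ 0 by omega) (by omega)]
  omega

/-- The new vote doubles the threshold T past the residents, so the a old voters and c residents go
from the server into the blob. For a ≠ 0 the credit rises from a + 7T to a + 1 + 8T + c, which pays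
a + c since a < T. -/
theorem voteCredit_succ_of_lt_of_le {a c : ℕ} (h : threshold a ≤ c) (h' : c < threshold (a + 1)) :
    voteCredit a c + (a + c) ≤ voteCredit (a + 1) c := by
  have ha' := lt_threshold a
  have hs := threshold_succ a
  rw [voteCredit_of_lt (show a + 1 ≠ 0 by omega) h']
  rcases eq_or_ne a 0 with rfl | ha
  · rw [voteCredit_zero]
    omega
  · rw [voteCredit_of_le ha h]
    omega

theorem voteCredit_succ_of_le {a c : ℕ} (h : threshold (a + 1) ≤ c) :
    voteCredit a c + 1 ≤ voteCredit (a + 1) c := by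
  have hs := threshold_succ a
  rw [voteCredit_of_le (show a + 1 ≠ 0 by omega) h]
  rcases eq_or_ne a 0 with rfl | ha
  · rw [voteCredit_zero]
    omega
  · rw [voteCredit_of_le ha (by omega)]
    omega

theorem voteCredit_add_of_lt {a c x : ℕ} (h : c + x < threshold a) :
    voteCredit a c + x ≤ voteCredit a (c + x) := by
  rcases eq_or_ne a 0 with rfl | ha
  · rw [threshold_zero] at h
    rw [voteCredit_zero]
    omega
  · rw [voteCredit_of_lt ha h, voteCredit_of_lt ha (by omega)]
    omega

/-- New residents reach the threshold T, so the old voters and residents leave the blob for the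
server. For a ≠ 0 the credit rises from a + 4T + c to a + 7T, and 3T − c ≥ a + c because a, c < T.
-/
theorem voteCredit_add_of_lt_of_le {a c x : ℕ} (h : c < threshold a) (h' : threshold a ≤ c + x) :
    voteCredit a c + (a + c) ≤ voteCredit a (c + x) := by
  have := lt_threshold a
  rcases eq_or_ne a 0 with rfl | ha
  · rw [threshold_zero] at h
    rw [voteCredit_zero]
    omega
  · rw [voteCredit_of_lt ha h, voteCredit_of_le ha h']
    omega

theorem voteCredit_add_of_le {a c x : ℕ} (h : threshold a ≤ c) :
    voteCredit a c ≤ voteCredit a (c + x) := by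
  rcases eq_or_ne a 0 with rfl | ha
  · simp [voteCredit_zero]
  · rw [voteCredit_of_le ha h, voteCredit_of_le ha (by omega)]

/-! ### Labels, configurations and the potential of a learning state. -/

namespace LearnState

section Label

variable {V : Type*} {D : ℕ} {L L' : LearnState V} {r : V}

/-- A process of charge less than `D` stands for itself; the others stand for the process they
vote for. -/
def label (D : ℕ) (L : LearnState V) (v : V) : Option V := if D ≤ L.charge v then L.vote v else some v

theorem label_of_lt {v : V} (h : L.charge v < D) : L.label D v = some v := by
  simp [label, not_le.2 h]

theorem label_of_le {v : V} (h : D ≤ L.charge v) : L.label D v = L.vote v := by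
  simp [label, h]

/-- The components with representative `r` in `L` and `L'` are the same and in the same state. -/
def AgreeOn (L L' : LearnState V) (r : V) : Prop :=
  ∀ v, (L'.rep v = r ↔ L.rep v = r) ∧
    (L.rep v = r → L'.charge v = L.charge v ∧ L'.vote v = L.vote v)

theorem AgreeOn.label (h : AgreeOn L L' r) {v : V} (hv : L.rep v = r) :
    L'.label D v = L.label D v := by
  unfold LearnState.label
  rw [((h v).2 hv).1, ((h v).2 hv).2]

end Label

variable {V S : Type*} [Fintype V] [DecidableEq V] [DecidableEq S]

section Defs

variable (D : ℕ) (home : V → S) (L : LearnState V)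

/-- The component with representative `r`. -/
def cls (r : V) : Finset V := Finset.univ.filter fun v => L.rep v = r

/-- The tight processes of a component: those of charge at least `D`. -/
def tight (r : V) : Finset V := Finset.univ.filter fun v => L.rep v = r ∧ D ≤ L.charge v

/-- The tight processes of a component that vote for a process with home `s`. -/
def voters (r : V) (s : S) : Finset V :=
  Finset.univ.filter fun v => L.rep v = r ∧ D ≤ L.charge v ∧ (L.vote v).map home = some s

/-- The processes of a component that are not tight and have home `s`. -/
def residents (r : V) (s : S) : Finset V :=
  Finset.univ.filter fun v => L.rep v = r ∧ L.charge v < D ∧ home v = s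

/-- The voters and residents for server `s` are kept in the blob of the component. -/
def InBlob (r : V) (s : S) : Prop :=
  (L.residents D home r s).card < threshold (L.voters D home r s).card

/-- The component `r` is kept in its blob as a whole. -/
def Big (r : V) : Prop := D ≤ (L.tight D r).card

/-- The process `v` is kept in the blob of its component. -/
def Gathered (v : V) : Prop :=
  L.Big D (L.rep v) ∨ ∀ u, L.label D v = some u → L.InBlob D home (L.rep v) (home u)

/-- The server of a process that is not kept in a blob. -/
def base (v : V) : S := home ((L.label D v).getD v)

/-- The configuration of the algorithm if the blob of component `r` is on server `β r`. -/
noncomputable def config (β : V → S) : Config V S :=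
  blobConfig (L.Gathered D home) L.rep (L.base D home) β

/-- An upper bound for the cost that was spent on component `r`, except for the cost that is paid
for by charges. -/
noncomputable def credit [Fintype S] (k : ℕ) (r : V) : ℕ :=
  if D ≤ (L.tight D r).card then 80 * (D * (L.tight D r).card) + (L.cls r).card - 2 * k
  else 40 * (D * ((L.tight D r).card - 1)) +
    ∑ s, voteCredit (L.voters D home r s).card (L.residents D home r s).card

/-- An upper bound for the cost that was spent. -/
noncomputable def potential [Fintype S] (k : ℕ) : ℕ :=
  ∑ r, L.credit D home k r + 10 * ∑ v, L.charge v

end Defs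

variable {D k : ℕ} {home : V → S} {L L' : LearnState V} {r : V}

theorem config_of_big (β : V → S) {v : V} (h : L.Big D (L.rep v)) :
    L.config D home β v = β (L.rep v) := by
  unfold config blobConfig
  rw [if_pos (show L.Gathered D home v from Or.inl h)]

/-- Without a label the second alternative of `Gathered` is vacuous, so undecided processes are in
the blob and the default value in `base` is never used. -/
theorem config_of_label_none (β : V → S) {v : V} (h : L.label D v = none) :
    L.config D home β v = β (L.rep v) := by
  unfold config blobConfig
  rw [if_pos (show L.Gathered D home v from Or.inr (by simp [h]))]

theorem config_of_inBlob (β : V → S) {v u : V} (h : L.label D v = some u)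
    (hb : L.InBlob D home (L.rep v) (home u)) : L.config D home β v = β (L.rep v) := by
  unfold config blobConfig
  rw [if_pos (show L.Gathered D home v from Or.inr (by simpa [h] using hb))]

theorem config_of_not_inBlob (β : V → S) {v u : V} (hbig : ¬ L.Big D (L.rep v))
    (h : L.label D v = some u) (hb : ¬ L.InBlob D home (L.rep v) (home u)) :
    L.config D home β v = home u := by
  unfold config blobConfig
  rw [if_neg]
  · simp [base, h]
  · rintro (h' | h')
    · exact hbig h'
    · exact hb (h' u h)

theorem sum_card_voters_le [Fintype S] (r : V) :
    ∑ s, (L.voters D home r s).card ≤ (L.tight D r).card := by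
  rw [← Finset.card_biUnion]
  · refine Finset.card_le_card fun v hv => ?_
    simp only [voters, tight, Finset.mem_biUnion, Finset.mem_filter, Finset.mem_univ,
      true_and] at hv ⊢
    obtain ⟨s, h⟩ := hv
    exact ⟨h.1, h.2.1⟩
  · intro s _ t _ hst
    rw [Function.onFun, Finset.disjoint_left]
    intro v hv hv'
    simp only [voters, Finset.mem_filter, Finset.mem_univ, true_and] at hv hv'
    exact hst (Option.some_injective _ (hv.2.2.symm.trans hv'.2.2))

theorem sum_voteCredit_le [Fintype S] (r : V) :
    ∑ s, voteCredit (L.voters D home r s).card (L.residents D home r s).card ≤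
      15 * (L.tight D r).card := by
  refine le_trans (Finset.sum_le_sum fun s _ => voteCredit_le _ _) ?_
  rw [← Finset.mul_sum]
  exact Nat.mul_le_mul_left _ (sum_card_voters_le r)

theorem mem_voters_or_residents {v u : V} (h : L.label D v = some u) :
    v ∈ L.voters D home (L.rep v) (home u) ∨ v ∈ L.residents D home (L.rep v) (home u) := by
  simp only [voters, residents, Finset.mem_filter, Finset.mem_univ, true_and]
  rcases Nat.lt_or_ge (L.charge v) D with hc | hc
  · right
    rw [label_of_lt hc] at h
    exact ⟨hc, by rw [Option.some_injective _ h]⟩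
  · left
    rw [label_of_le hc] at h
    exact ⟨hc, by simp [h]⟩

/-- The processes of a component that are not at their homes. -/
theorem card_displaced_le [Fintype S] (β : V → S) (hbig : ¬ L.Big D r) :
    (Finset.univ.filter fun v => L.rep v = r ∧ L.config D home β v ≠ home v).card ≤
      3 * (L.tight D r).card := by
  -- `X s` holds the residents of `s` kept in the blob: fewer than the threshold, hence at most
  -- twice the voters. They contribute 2m in total, and the tight processes contribute m.
  set X : S → Finset V := fun s =>
    if (L.residents D home r s).card < threshold (L.voters D home r s).card
      then L.residents D home r s else ∅ with hX
  have hXc : ∀ s, (X s).card ≤ 2 * (L.voters D home r s).card := by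
    intro s
    simp only [hX]
    split_ifs with h
    · rcases Nat.eq_zero_or_pos (L.voters D home r s).card with h0 | h0
      · rw [h0, threshold_zero] at h
        omega
      · have := threshold_le h0.ne'
        omega
    · simp
  have hsub : (Finset.univ.filter fun v => L.rep v = r ∧ L.config D home β v ≠ home v) ⊆
      L.tight D r ∪ Finset.univ.biUnion X := by
    intro v hv
    simp only [Finset.mem_filter, Finset.mem_univ, true_and] at hv
    obtain ⟨rfl, hne⟩ := hv
    rw [Finset.mem_union, Finset.mem_biUnion]
    rcases Nat.lt_or_ge (L.charge v) D with hc | hc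
    · right
      by_cases hb : L.InBlob D home (L.rep v) (home v)
      · refine ⟨home v, Finset.mem_univ _, ?_⟩
        simp only [hX]
        unfold InBlob at hb
        rw [if_pos hb]
        simp [residents, hc]
      · exact absurd (config_of_not_inBlob β hbig (label_of_lt hc) hb) hne
    · left
      simp [tight, hc]
  refine (Finset.card_le_card hsub).trans ((Finset.card_union_le _ _).trans ?_)
  have h1 : (Finset.univ.biUnion X).card ≤ 2 * (L.tight D r).card := by
    refine Finset.card_biUnion_le.trans ((Finset.sum_le_sum fun s _ => hXc s).trans ?_)
    rw [← Finset.mul_sum]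
    exact Nat.mul_le_mul_left _ (sum_card_voters_le r)
  omega

/-- Without votes every threshold is `threshold 0 = 1`, and `v` itself is a resident of its home
server, so this threshold is reached. -/
theorem config_eq_home_of_vote_none (β : V → S) {v : V} (hbig : ¬ L.Big D (L.rep v))
    (hvote : ∀ u, L.rep u = L.rep v → L.vote u = none) (hv : L.charge v < D) :
    L.config D home β v = home v := by
  refine config_of_not_inBlob β hbig (label_of_lt hv) ?_
  have h0 : L.voters D home (L.rep v) (home v) = ∅ := by
    refine Finset.eq_empty_of_forall_notMem fun u hu => ?_
    simp only [voters, Finset.mem_filter, Finset.mem_univ, true_and] at hu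
    simp [hvote u hu.1] at hu
  have h1 : 0 < (L.residents D home (L.rep v) (home v)).card :=
    Finset.card_pos.2 ⟨v, by simp [residents, hv]⟩
  rw [InBlob, h0, Finset.card_empty, threshold_zero]
  omega

namespace AgreeOn

theorem cls (h : AgreeOn L L' r) : L'.cls r = L.cls r := by
  unfold LearnState.cls
  exact Finset.filter_congr fun v _ => (h v).1

theorem tight (h : AgreeOn L L' r) : L'.tight D r = L.tight D r := by
  unfold LearnState.tight
  refine Finset.filter_congr fun v _ => ?_
  rw [(h v).1]
  exact and_congr_right fun hv => by rw [((h v).2 hv).1]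

theorem voters (h : AgreeOn L L' r) (s : S) : L'.voters D home r s = L.voters D home r s := by
  unfold LearnState.voters
  refine Finset.filter_congr fun v _ => ?_
  rw [(h v).1]
  exact and_congr_right fun hv => by rw [((h v).2 hv).1, ((h v).2 hv).2]

theorem residents (h : AgreeOn L L' r) (s : S) :
    L'.residents D home r s = L.residents D home r s := by
  unfold LearnState.residents
  refine Finset.filter_congr fun v _ => ?_
  rw [(h v).1]
  exact and_congr_right fun hv => by rw [((h v).2 hv).1]

theorem credit [Fintype S] (h : AgreeOn L L' r) :
    L'.credit D home k r = L.credit D home k r := by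
  unfold LearnState.credit
  rw [h.tight, h.cls]
  simp only [h.voters, h.residents]

theorem config (h : AgreeOn L L' r) (β : V → S) {v : V} (hv : L.rep v = r) :
    L'.config D home β v = L.config D home β v := by
  have hv' : L'.rep v = r := (h v).1.2 hv
  have hbig : L'.Big D (L'.rep v) ↔ L.Big D (L.rep v) := by
    rw [Big, Big, hv, hv', h.tight]
  have hblob : ∀ s, L'.InBlob D home (L'.rep v) s ↔ L.InBlob D home (L.rep v) s := by
    intro s
    rw [InBlob, InBlob, hv, hv', h.voters, h.residents]
  have hG : L'.Gathered D home v ↔ L.Gathered D home v := by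
    simp only [Gathered, hbig, hblob, h.label hv]
  unfold LearnState.config blobConfig
  by_cases hg : L.Gathered D home v
  · rw [if_pos (hG.2 hg), if_pos hg, hv, hv']
  · rw [if_neg fun h' => hg (hG.1 h'), if_neg hg, base, base, h.label hv]

end AgreeOn

theorem potential_le_of_agreeOn [Fintype S] {x : ℕ} (h : ∀ t, t ≠ r → AgreeOn L L' t)
    (hr : x + L.credit D home k r + 10 * ∑ v, L.charge v ≤
      L'.credit D home k r + 10 * ∑ v, L'.charge v) :
    x + L.potential D home k ≤ L'.potential D home k := by
  unfold potential
  rw [← Finset.add_sum_erase _ _ (Finset.mem_univ r),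
    ← Finset.add_sum_erase _ (L'.credit D home k) (Finset.mem_univ r),
    Finset.sum_congr rfl fun t ht => (h t (Finset.ne_of_mem_erase ht)).credit]
  omega

theorem potential_le_of_agreeOn₂ [Fintype S] {x : ℕ} {w l : V} (hwl : w ≠ l)
    (h : ∀ t, t ≠ w → t ≠ l → AgreeOn L L' t)
    (hr : x + (L.credit D home k w + L.credit D home k l) ≤
      L'.credit D home k w + L'.credit D home k l) (hc : L'.charge = L.charge) :
    x + L.potential D home k ≤ L'.potential D home k := by
  have hl : l ∈ Finset.univ.erase w := Finset.mem_erase.2 ⟨hwl.symm, Finset.mem_univ l⟩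
  unfold potential
  rw [hc, ← Finset.add_sum_erase _ _ (Finset.mem_univ w),
    ← Finset.add_sum_erase _ (L'.credit D home k) (Finset.mem_univ w),
    ← Finset.add_sum_erase _ _ hl, ← Finset.add_sum_erase _ (L'.credit D home k) hl,
    Finset.sum_congr rfl fun t ht => (h t (Finset.ne_of_mem_erase (Finset.mem_of_mem_erase ht))
      (Finset.ne_of_mem_erase ht)).credit]
  omega

/-- The first tight process earns nothing in the term 40·D·(m − 1), which is 0 for m = 0 as well.
Merging two components with tight processes thus releases an extra 40·D. -/
theorem credit_le_of_not_big [Fintype S] (h : ¬ L.Big D r) :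
    L.credit D home k r ≤
      40 * (D * ((L.tight D r).card - 1)) + 15 * (L.tight D r).card := by
  unfold credit
  unfold Big at h
  rw [if_neg h]
  exact Nat.add_le_add_left (sum_voteCredit_le r) _

/-- The term `(L.cls r).card` pays for moving the members into the blob. When k ≤ D², bigness gives
k ≤ D·m, so the subtraction does not truncate. -/
theorem credit_of_big [Fintype S] (h : L.Big D r) :
    L.credit D home k r = 80 * (D * (L.tight D r).card) + (L.cls r).card - 2 * k := by
  unfold credit
  unfold Big at h
  rw [if_pos h]

theorem le_credit_of_not_big [Fintype S] (h : ¬ L.Big D r) :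
    40 * (D * ((L.tight D r).card - 1)) ≤ L.credit D home k r := by
  unfold credit
  unfold Big at h
  rw [if_neg h]
  exact Nat.le_add_right _ _

end LearnState

end BalancedPartitioning

/-! ### Voting, charging and merging, each paid for by the potential. -/

namespace BalancedPartitioning

namespace LearnState

section Operations

variable {V : Type*} [DecidableEq V]

/-- The process `p` votes for `u`. -/
def setVote (L : LearnState V) (p u : V) : LearnState V where
  rep := L.rep
  charge := L.charge
  vote := Function.update L.vote p (some u)

variable [Fintype V]

/-- Two processes `u` and `u'` of component `r` are charged for the work in this component, and all
votes in the component are deleted. -/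
def penalize (D : ℕ) (L : LearnState V) (r u u' : V) : LearnState V where
  rep := L.rep
  charge := fun v => L.charge v + if v = u ∨ v = u' then (L.tight D r).card + 1 else 0
  vote := fun v => if L.rep v = r then none else L.vote v

/-- Component `l` is merged into component `w`. All their votes are deleted unless `l` has no tight
process. -/
def merge (D : ℕ) (L : LearnState V) (w l : V) : LearnState V where
  rep := fun v => if L.rep v = l then w else L.rep v
  charge := L.charge
  vote := fun v => if (L.tight D l).Nonempty ∧ (L.rep v = w ∨ L.rep v = l) then none else L.vote v

end Operations

section SetVote

variable {V : Type*} [DecidableEq V] {D : ℕ} {L : LearnState V} {p u : V}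

theorem label_setVote_self (hp : D ≤ L.charge p) : (L.setVote p u).label D p = some u := by
  rw [label_of_le (L := L.setVote p u) hp]
  simp [setVote]

theorem label_setVote_of_ne {v : V} (hv : v ≠ p) :
    (L.setVote p u).label D v = L.label D v := by
  simp [label, setVote, hv]

theorem agreeOn_setVote {t : V} (ht : t ≠ L.rep p) : L.AgreeOn (L.setVote p u) t := by
  intro v
  refine ⟨Iff.rfl, fun hv => ⟨rfl, ?_⟩⟩
  have : v ≠ p := by
    rintro rfl
    exact ht hv.symm
  simp [setVote, this]

end SetVote

variable {V S : Type*} [Fintype V] [DecidableEq V] [DecidableEq S]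
variable {D k : ℕ} {home : V → S} {L L' : LearnState V} {r : V}

theorem config_eq_config (β : V → S) {v : V} (hrep : L'.rep v = L.rep v)
    (hbig : ¬ L.Big D (L.rep v)) (hbig' : ¬ L'.Big D (L.rep v))
    (hl : L'.label D v = L.label D v)
    (hb : ∀ u, L.label D v = some u →
      (L'.InBlob D home (L.rep v) (home u) ↔ L.InBlob D home (L.rep v) (home u))) :
    L.config D home β v = L'.config D home β v := by
  rcases h : L.label D v with _ | u
  · rw [config_of_label_none β h, config_of_label_none β (hl.trans h), hrep]
  · by_cases hu : L.InBlob D home (L.rep v) (home u)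
    · rw [config_of_inBlob β h hu, config_of_inBlob β (hl.trans h) (by rwa [hrep, hb u h]), hrep]
    · rw [config_of_not_inBlob β hbig h hu,
        config_of_not_inBlob β (by rwa [hrep]) (hl.trans h) (by rwa [hrep, hb u h])]

section SetVote

variable {p u : V}

theorem voters_setVote_self (hp : D ≤ L.charge p) :
    (L.setVote p u).voters D home (L.rep p) (home u) =
      insert p (L.voters D home (L.rep p) (home u)) := by
  ext v
  simp only [voters, setVote, Finset.mem_filter, Finset.mem_univ, true_and, Finset.mem_insert]
  by_cases hv : v = p
  · subst hv
    simp [hp]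
  · simp [hv]

theorem voters_setVote_of_ne (hvote : L.vote p = none) {s : S} (hs : s ≠ home u) :
    (L.setVote p u).voters D home r s = L.voters D home r s := by
  ext v
  simp only [voters, setVote, Finset.mem_filter, Finset.mem_univ, true_and]
  by_cases hv : v = p
  · subst hv
    simp [hvote, hs.symm]
  · simp [hv]

theorem migrationCost_setVote [Fintype S] (β : V → S) (hp : D ≤ L.charge p)
    (hvote : L.vote p = none) (hbig : ¬ L.Big D (L.rep p)) :
    migrationCost (L.config D home β) ((L.setVote p u).config D home β) +
      L.potential D home k ≤ (L.setVote p u).potential D home k := by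
  set L' := L.setVote p u with hL'
  set A := L.voters D home (L.rep p) (home u) with hA
  set C := L.residents D home (L.rep p) (home u) with hC
  have hpA : p ∉ A := by simp [hA, voters, hvote]
  have hA' : (L'.voters D home (L.rep p) (home u)).card = A.card + 1 := by
    rw [voters_setVote_self hp, Finset.card_insert_of_notMem hpA]
  have hbig' : ¬ L'.Big D (L.rep p) := hbig
  have hlp : L.label D p = none := by rw [label_of_le hp, hvote]
  have hlp' : L'.label D p = some u := label_setVote_self hp
  -- The processes that may move: none if the group was already in the blob; the old voters and
  -- residents if this vote pulls them into the blob, where `p` already is; otherwise `p` alone,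
  -- from the blob to `home u`.
  set X : Finset V := if C.card < threshold A.card then ∅ else
    if C.card < threshold (A.card + 1) then A ∪ C else {p} with hX
  have hmove : migrationCost (L.config D home β) (L'.config D home β) ≤ X.card := by
    unfold migrationCost
    refine Finset.card_le_card fun v hv => ?_
    simp only [Finset.mem_filter, Finset.mem_univ, true_and] at hv
    by_contra hvX
    apply hv
    by_cases hr : L.rep v = L.rep p
    swap
    · exact ((agreeOn_setVote hr).config β rfl).symm
    have hin : L.InBlob D home (L.rep p) (home u) ↔ C.card < threshold A.card := Iff.rfl
    have hin' : L'.InBlob D home (L.rep p) (home u) ↔ C.card < threshold (A.card + 1) := by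
      unfold InBlob
      rw [hA']
      exact Iff.rfl
    have hle : threshold A.card ≤ threshold (A.card + 1) := by
      rcases threshold_succ A.card with h | h <;> omega
    by_cases hvp : v = p
    · subst hvp
      rw [config_of_label_none β hlp]
      by_cases hb : L'.InBlob D home (L.rep v) (home u)
      · rw [config_of_inBlob β hlp' hb]
        rfl
      · rw [hin'] at hb
        refine absurd ?_ hvX
        rw [hX, if_neg (by omega), if_neg hb]
        exact Finset.mem_singleton_self _
    · refine config_eq_config β rfl (by rwa [hr]) (by rwa [hr]) (label_setVote_of_ne hvp) ?_
      intro x hx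
      rw [hr]
      by_cases hxu : home x = home u
      · rw [hxu, hin, hin']
        refine ⟨fun h => ?_, fun h => h.trans_le hle⟩
        by_contra hnot
        refine hvX ?_
        rw [hX, if_neg hnot, if_pos h, Finset.mem_union]
        have := mem_voters_or_residents (home := home) hx
        rwa [hr, hxu] at this
      · unfold InBlob
        rw [voters_setVote_of_ne hvote hxu]
        exact Iff.rfl
  have hcredit : X.card + voteCredit A.card C.card ≤ voteCredit (A.card + 1) C.card := by
    rw [hX]
    split_ifs with h1 h2
    · simpa using voteCredit_succ_of_lt h1
    · have := voteCredit_succ_of_lt_of_le (not_lt.1 h1) h2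
      have := Finset.card_union_le A C
      omega
    · have := voteCredit_succ_of_le (not_lt.1 h2)
      simp only [Finset.card_singleton]
      omega
  refine le_trans (Nat.add_le_add_right hmove _)
    (potential_le_of_agreeOn (r := L.rep p) (fun t ht => agreeOn_setVote ht) ?_)
  unfold credit
  unfold Big at hbig hbig'
  rw [if_neg hbig, if_neg hbig', ← Finset.add_sum_erase _ _ (Finset.mem_univ (home u)),
    ← Finset.add_sum_erase _ (fun s => voteCredit (L'.voters D home (L.rep p) s).card
      (L'.residents D home (L.rep p) s).card) (Finset.mem_univ (home u))]
  have hsum : ∑ s ∈ Finset.univ.erase (home u), voteCredit (L'.voters D home (L.rep p) s).card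
      (L'.residents D home (L.rep p) s).card =
      ∑ s ∈ Finset.univ.erase (home u), voteCredit (L.voters D home (L.rep p) s).card
      (L.residents D home (L.rep p) s).card := by
    refine Finset.sum_congr rfl fun s hs => ?_
    rw [voters_setVote_of_ne hvote (Finset.ne_of_mem_erase hs)]
    rfl
  have hres : L'.residents D home (L.rep p) (home u) = C := rfl
  have htight : L'.tight D (L.rep p) = L.tight D (L.rep p) := rfl
  have hch : L'.charge = L.charge := rfl
  simp only [hsum, hA', hres, htight, hch, ← hA, ← hC]
  omega

end SetVote

/-- Deleting the votes moves only processes that were away from home or are tight. -/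
theorem migrationCost_le_of_vote_none (β : V → S) {X : Finset V}
    (hout : ∀ v, v ∉ X → L.config D home β v = L'.config D home β v)
    (hX : ∀ v ∈ X, L'.rep v = r) (hvote : ∀ v, L'.rep v = r → L'.vote v = none)
    (hbig : ¬ L'.Big D r) :
    migrationCost (L.config D home β) (L'.config D home β) ≤
      (X.filter fun v => L.config D home β v ≠ home v).card + (L'.tight D r).card := by
  unfold migrationCost
  refine (Finset.card_le_card fun v hv => ?_).trans (Finset.card_union_le _ _)
  simp only [Finset.mem_filter, Finset.mem_univ, true_and, Finset.mem_union, tight] at hv ⊢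
  have hvX : v ∈ X := by
    by_contra h
    exact hv (hout v h)
  have hr := hX v hvX
  by_contra! h
  have hlt : L'.charge v < D := h.2 hr
  refine hv ((h.1 hvX).trans (config_eq_home_of_vote_none β (by rwa [hr]) ?_ hlt).symm)
  intro u hu
  exact hvote u (hu.trans hr)

theorem migrationCost_le_of_eq (c c' : Config V S) {X : Finset V}
    (hout : ∀ v, v ∉ X → c v = c' v) : migrationCost c c' ≤ X.card := by
  unfold migrationCost
  refine Finset.card_le_card fun v hv => ?_
  simp only [Finset.mem_filter, Finset.mem_univ, true_and] at hv
  by_contra h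
  exact hv (hout v h)

section Penalize

variable {u u' : V}

theorem agreeOn_penalize (hu : L.rep u = r) (hu' : L.rep u' = r) {t : V} (ht : t ≠ r) :
    L.AgreeOn (L.penalize D r u u') t := by
  intro v
  refine ⟨Iff.rfl, fun hv => ?_⟩
  have hvr : L.rep v ≠ r := by rwa [hv]
  have h1 : v ≠ u := fun h => hvr (h ▸ hu)
  have h2 : v ≠ u' := fun h => hvr (h ▸ hu')
  simp [penalize, h1, h2, hvr]

theorem sum_charge_penalize (X : Finset V) :
    ∑ v ∈ X, (L.penalize D r u u').charge v =
      ∑ v ∈ X, L.charge v +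
        (X.filter fun v => v = u ∨ v = u').card * ((L.tight D r).card + 1) := by
  unfold penalize
  simp only
  rw [Finset.sum_add_distrib, ← Finset.sum_filter, Finset.sum_const, smul_eq_mul]

theorem card_filter_eq_or_eq (huu' : u ≠ u') :
    (Finset.univ.filter fun v => v = u ∨ v = u').card = 2 := by
  rw [← Finset.card_pair huu']
  congr 1
  ext v
  simp

/-- If the component does not become big, dropping the votes moves at most 3m + (m + 2) processes,
the lost vote credit is at most 15m and the request costs at most 1; the new charges add 20(m + 1)
to the potential. If it becomes big, all of it may move; the size term of the new credit pays for
this, and 80·D·m' − 2k, with m' the new number of tight processes, covers the old credit. -/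
theorem migrationCost_penalize [Fintype S] (β : V → S) (hkD : k ≤ D * D)
    (huu' : u ≠ u') (hu : L.rep u = r) (hu' : L.rep u' = r) (hbig : ¬ L.Big D r) :
    migrationCost (L.config D home β) ((L.penalize D r u u').config D home β) + 1 +
      L.potential D home k ≤ (L.penalize D r u u').potential D home k := by
  set L' := L.penalize D r u u' with hL'
  have hagree : ∀ t, t ≠ r → L.AgreeOn L' t := fun t ht => agreeOn_penalize hu hu' ht
  have hout : ∀ v, v ∉ L.cls r → L.config D home β v = L'.config D home β v := by
    intro v hv
    have hvr : L.rep v ≠ r := by simpa [cls] using hv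
    exact ((hagree _ hvr).config β rfl).symm
  have hcls : L'.cls r = L.cls r := rfl
  have hsub : L.tight D r ⊆ L'.tight D r := by
    intro v hv
    simp only [tight, hL', penalize, Finset.mem_filter, Finset.mem_univ, true_and] at hv ⊢
    exact ⟨hv.1, hv.2.trans (Nat.le_add_right _ _)⟩
  have hsub' : L'.tight D r ⊆ L.tight D r ∪ {u, u'} := by
    intro v hv
    simp only [tight, hL', penalize, Finset.mem_filter, Finset.mem_univ, true_and,
      Finset.mem_union, Finset.mem_insert, Finset.mem_singleton] at hv ⊢
    by_cases h : v = u ∨ v = u'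
    · exact Or.inr h
    · rw [if_neg h] at hv
      exact Or.inl hv
  have hm := Finset.card_le_card hsub
  have hm' : (L'.tight D r).card ≤ (L.tight D r).card + 2 := by
    refine (Finset.card_le_card hsub').trans ((Finset.card_union_le _ _).trans ?_)
    rw [Finset.card_pair huu']
  have hsum : ∑ v, L'.charge v = ∑ v, L.charge v + 2 * ((L.tight D r).card + 1) := by
    rw [hL', sum_charge_penalize, card_filter_eq_or_eq huu']
  refine potential_le_of_agreeOn hagree ?_
  rw [hsum]
  have hc := credit_le_of_not_big (home := home) (k := k) hbig
  by_cases hbig' : L'.Big D r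
  · have hmove := migrationCost_le_of_eq _ _ hout
    rw [credit_of_big hbig', hcls]
    have h1 : D * ((L.tight D r).card - 1) ≤ D * (L'.tight D r).card :=
      Nat.mul_le_mul_left _ (by omega)
    have h2 : k ≤ D * (L'.tight D r).card := hkD.trans (Nat.mul_le_mul_left _ hbig')
    have h3 : D * (L.tight D r).card ≤ D * (L'.tight D r).card := Nat.mul_le_mul_left _ hm
    have h4 : (L.tight D r).card ≤ D * (L.tight D r).card := by
      have : 0 < D := by
        unfold Big at hbig
        omega
      exact Nat.le_mul_of_pos_left _ this
    omega
  · have hmove := migrationCost_le_of_vote_none (r := r) β hout (fun v hv => by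
      change L.rep v = r
      simpa [cls] using hv) (fun v hv => by
        have : L.rep v = r := hv
        simp [hL', penalize, this]) hbig'
    have hdis := card_displaced_le (home := home) β hbig
    rw [← Finset.filter_filter] at hdis
    have hc' := le_credit_of_not_big (home := home) (k := k) hbig'
    have h1 : D * ((L.tight D r).card - 1) ≤ D * ((L'.tight D r).card - 1) :=
      Nat.mul_le_mul_left _ (by omega)
    have hmove' : migrationCost (L.config D home β) (L'.config D home β) ≤
      3 * (L.tight D r).card + (L'.tight D r).card :=
        hmove.trans (Nat.add_le_add_right hdis _)
    omega

end Penalize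

section Merge

variable {w l : V}

theorem agreeOn_merge {t : V} (htw : t ≠ w) (htl : t ≠ l) : L.AgreeOn (L.merge D w l) t := by
  intro v
  constructor
  · simp only [merge]
    split_ifs with h
    · rw [h]
      exact ⟨fun h' => absurd h'.symm htw, fun h' => absurd h'.symm htl⟩
    · rfl
  · rintro rfl
    simp [merge, htw, htl]

theorem rep_merge_eq_iff {v : V} :
    (L.merge D w l).rep v = w ↔ L.rep v = w ∨ L.rep v = l := by
  simp only [merge]
  split_ifs with h
  · simp [h]
  · simp [h]

theorem cls_merge : (L.merge D w l).cls w = L.cls w ∪ L.cls l := by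
  ext v
  simp only [cls, Finset.mem_filter, Finset.mem_univ, true_and, Finset.mem_union,
    rep_merge_eq_iff]

theorem disjoint_cls (hwl : w ≠ l) : Disjoint (L.cls w) (L.cls l) := by
  rw [Finset.disjoint_left]
  intro v hv hv'
  simp only [cls, Finset.mem_filter, Finset.mem_univ, true_and] at hv hv'
  exact hwl (hv.symm.trans hv')

theorem tight_subset_cls : L.tight D r ⊆ L.cls r := by
  intro v hv
  simp only [cls, tight, Finset.mem_filter, Finset.mem_univ, true_and] at hv ⊢
  exact hv.1

theorem card_cls_merge (hwl : w ≠ l) :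
    ((L.merge D w l).cls w).card = (L.cls w).card + (L.cls l).card := by
  rw [cls_merge, Finset.card_union_of_disjoint (disjoint_cls hwl)]

theorem card_tight_merge (hwl : w ≠ l) :
    ((L.merge D w l).tight D w).card = (L.tight D w).card + (L.tight D l).card := by
  have : (L.merge D w l).tight D w = L.tight D w ∪ L.tight D l := by
    ext v
    simp only [tight, Finset.mem_filter, Finset.mem_univ, true_and, Finset.mem_union,
      rep_merge_eq_iff]
    have : (L.merge D w l).charge v = L.charge v := rfl
    rw [this]
    tauto
  rw [this, Finset.card_union_of_disjoint]
  exact Finset.disjoint_of_subset_left tight_subset_cls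
    (Finset.disjoint_of_subset_right tight_subset_cls (disjoint_cls hwl))

theorem vote_merge_of_not_nonempty (h : ¬ (L.tight D l).Nonempty) :
    (L.merge D w l).vote = L.vote := by
  funext v
  simp [merge, h]

theorem config_merge_of_notMem (β : V → S) {v : V}
    (hv : v ∉ L.cls w ∪ L.cls l) :
    L.config D home β v = (L.merge D w l).config D home β v := by
  simp only [cls, Finset.mem_filter, Finset.mem_univ, true_and, Finset.mem_union, not_or] at hv
  exact ((agreeOn_merge hv.1 hv.2).config β rfl).symm

/-- The blob of `w` keeps its name, so only component `l` moves, and the size term grows by just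
that. If `l` was big too, its size was already counted; then fusing two terms −2k into one releases
2k, which suffices. -/
theorem migrationCost_merge_of_big [Fintype S] (β : V → S) (hkD : k ≤ D * D) (hD : 0 < D)
    (hwl : w ≠ l) (hcls : ((L.merge D w l).cls w).card ≤ k) (hbig : L.Big D w) :
    migrationCost (L.config D home β) ((L.merge D w l).config D home β) +
      (L.credit D home k w + L.credit D home k l) ≤ (L.merge D w l).credit D home k w := by
  have hn := card_cls_merge (L := L) (D := D) hwl
  have hm := card_tight_merge (L := L) (D := D) hwl
  have hbig' : (L.merge D w l).Big D w := by
    unfold Big at hbig ⊢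
    omega
  have hmove : migrationCost (L.config D home β) ((L.merge D w l).config D home β) ≤
      (L.cls l).card := by
    refine migrationCost_le_of_eq _ _ fun v hv => ?_
    by_cases hvw : L.rep v = w
    · have hvw' : (L.merge D w l).rep v = w := rep_merge_eq_iff.2 (Or.inl hvw)
      rw [config_of_big β (by rwa [hvw]), config_of_big β (by rwa [hvw']), hvw, hvw']
    · refine config_merge_of_notMem β ?_
      rw [Finset.mem_union, not_or]
      exact ⟨by simpa [cls] using hvw, hv⟩
  rw [credit_of_big hbig, credit_of_big hbig', hn, hm, Nat.mul_add]
  have h1 : k ≤ D * (L.tight D w).card := hkD.trans (Nat.mul_le_mul_left _ hbig)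
  by_cases hbl : L.Big D l
  · rw [credit_of_big hbl]
    have h2 : k ≤ D * (L.tight D l).card := hkD.trans (Nat.mul_le_mul_left _ hbl)
    omega
  · have hc := credit_le_of_not_big (home := home) (k := k) hbl
    have h2 : D * ((L.tight D l).card - 1) ≤ D * (L.tight D l).card :=
      Nat.mul_le_mul_left _ (by omega)
    have h3 : (L.tight D l).card ≤ D * (L.tight D l).card := Nat.le_mul_of_pos_left _ hD
    omega

/-- The merger releases 40·D. If the result is not big, it has m < D tight processes, and moves (at
most 4m) plus lost vote credit (at most 15m) stay below that. If it is big, its size term pays for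
moving everything. -/
theorem migrationCost_merge_of_nonempty [Fintype S] (β : V → S) (hkD : k ≤ D * D)
    (hwl : w ≠ l) (hle : (L.tight D l).card ≤ (L.tight D w).card)
    (hbig : ¬ L.Big D w) (hne : (L.tight D l).Nonempty) :
    migrationCost (L.config D home β) ((L.merge D w l).config D home β) +
      (L.credit D home k w + L.credit D home k l) ≤ (L.merge D w l).credit D home k w := by
  set L' := L.merge D w l with hL'
  have hn : (L'.cls w).card = _ := card_cls_merge (L := L) (D := D) hwl
  have hm : (L'.tight D w).card = _ := card_tight_merge (L := L) (D := D) hwl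
  have hl1 : 1 ≤ (L.tight D l).card := hne.card_pos
  have hbl : ¬ L.Big D l := fun h => hbig (h.trans hle)
  have hout : ∀ v, v ∉ L.cls w ∪ L.cls l → L.config D home β v = L'.config D home β v :=
    fun v hv => config_merge_of_notMem β hv
  have hcw := credit_le_of_not_big (home := home) (k := k) hbig
  have hcl := credit_le_of_not_big (home := home) (k := k) hbl
  obtain ⟨a, ha⟩ : ∃ a, (L.tight D w).card = a + 1 := ⟨(L.tight D w).card - 1, by omega⟩
  obtain ⟨b, hb⟩ : ∃ b, (L.tight D l).card = b + 1 := ⟨(L.tight D l).card - 1, by omega⟩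
  unfold Big at hbig
  by_cases hbig' : L'.Big D w
  · have hmove := migrationCost_le_of_eq _ _ hout
    have hcard := Finset.card_union_le (L.cls w) (L.cls l)
    rw [credit_of_big hbig', hn]
    have h2 : k ≤ D * (L'.tight D w).card := hkD.trans (Nat.mul_le_mul_left _ hbig')
    rw [hm, ha, hb, show a + 1 + (b + 1) = a + b + 2 by ring] at h2
    rw [hm, ha, hb, show a + 1 + (b + 1) = a + b + 2 by ring]
    simp only [Nat.mul_add] at h2 ⊢
    rw [ha, Nat.add_sub_cancel] at hcw
    rw [hb, Nat.add_sub_cancel] at hcl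
    omega
  · have hmove := migrationCost_le_of_vote_none (r := w) β hout (fun v hv => by
      rw [hL', rep_merge_eq_iff]
      simpa [cls] using hv) (fun v hv => by
        rw [hL', rep_merge_eq_iff] at hv
        simp [hL', merge, hv, hne]) hbig'
    have hdw := card_displaced_le (home := home) β hbig
    have hdl := card_displaced_le (home := home) β hbl
    rw [← Finset.filter_filter] at hdw hdl
    have hdis : ((L.cls w ∪ L.cls l).filter fun v => L.config D home β v ≠ home v).card ≤
        3 * (L.tight D w).card + 3 * (L.tight D l).card := by
      rw [Finset.filter_union]
      exact (Finset.card_union_le _ _).trans (Nat.add_le_add hdw hdl)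
    have hc' := le_credit_of_not_big (home := home) (k := k) hbig'
    unfold Big at hbig'
    rw [hm, ha, hb, show a + 1 + (b + 1) - 1 = a + b + 1 by omega] at hc'
    simp only [Nat.mul_add] at hc'
    rw [ha, Nat.add_sub_cancel] at hcw
    rw [hb, Nat.add_sub_cancel] at hcl
    omega

/-- Without tight processes, `l` has no votes and all of it is at home. The merger keeps the votes
of `w` and only adds residents, so the vote credits account for it server by server. -/
theorem migrationCost_merge_of_empty [Fintype S] (β : V → S) (hD : 0 < D)
    (hwl : w ≠ l) (hbig : ¬ L.Big D w) (hne : ¬ (L.tight D l).Nonempty) :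
    migrationCost (L.config D home β) ((L.merge D w l).config D home β) +
      (L.credit D home k w + L.credit D home k l) ≤ (L.merge D w l).credit D home k w := by
  set L' := L.merge D w l with hL'
  have hlt : ∀ v, L.rep v = l → L.charge v < D := by
    intro v hv
    by_contra h
    exact hne ⟨v, by simp [tight, hv, not_lt.1 h]⟩
  have hl0 : (L.tight D l).card = 0 := by
    rw [Finset.card_eq_zero]
    exact Finset.not_nonempty_iff_eq_empty.1 hne
  have hm : (L'.tight D w).card = (L.tight D w).card := by
    rw [hL', card_tight_merge hwl, hl0, Nat.add_zero]
  have hbig' : ¬ L'.Big D w := by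
    unfold Big at hbig ⊢
    rwa [hm]
  have hbl : ¬ L.Big D l := by
    unfold Big
    omega
  have hcl := credit_le_of_not_big (home := home) (k := k) hbl
  rw [hl0] at hcl
  simp only [Nat.zero_sub, Nat.mul_zero, Nat.add_zero, Nat.le_zero] at hcl
  have hvoters : ∀ s, L'.voters D home w s = L.voters D home w s := by
    intro s
    ext v
    simp only [voters, Finset.mem_filter, Finset.mem_univ, true_and, hL',
      rep_merge_eq_iff, vote_merge_of_not_nonempty hne]
    constructor
    · rintro ⟨h1 | h1, h2, h3⟩
      · exact ⟨h1, h2, h3⟩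
      · exact absurd (hlt v h1) (not_lt.2 h2)
    · rintro ⟨h1, h2, h3⟩
      exact ⟨Or.inl h1, h2, h3⟩
  have hlabel : ∀ v, L'.label D v = L.label D v := by
    intro v
    unfold label
    rw [hL', vote_merge_of_not_nonempty hne]
    rfl
  have hvl : ∀ s, L.voters D home l s = ∅ := by
    intro s
    refine Finset.eq_empty_of_forall_notMem fun v hv => hne ⟨v, ?_⟩
    simp only [voters, tight, Finset.mem_filter, Finset.mem_univ, true_and] at hv ⊢
    exact ⟨hv.1, hv.2.1⟩
  have hres : ∀ s, (L'.residents D home w s).card =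
      (L.residents D home w s).card + (L.residents D home l s).card := by
    intro s
    rw [← Finset.card_union_of_disjoint]
    · congr 1
      ext v
      simp only [residents, Finset.mem_filter, Finset.mem_univ, true_and, hL',
        rep_merge_eq_iff, Finset.mem_union]
      have : (L.merge D w l).charge v = L.charge v := rfl
      rw [this]
      tauto
    · rw [Finset.disjoint_left]
      intro v hv hv'
      simp only [residents, Finset.mem_filter, Finset.mem_univ, true_and] at hv hv'
      exact hwl (hv.1.symm.trans hv'.1)
  -- The processes that may move: if the threshold is still not reached, the new residents join the
  -- blob; if they make it reached, the old group leaves the blob; otherwise nobody.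
  set X : S → Finset V := fun s =>
    if (L.residents D home w s).card + (L.residents D home l s).card <
        threshold (L.voters D home w s).card then L.residents D home l s
    else if (L.residents D home w s).card < threshold (L.voters D home w s).card then
      L.voters D home w s ∪ L.residents D home w s
    else ∅ with hX
  have hXc : ∀ s, (X s).card +
      voteCredit (L.voters D home w s).card (L.residents D home w s).card ≤
      voteCredit (L'.voters D home w s).card (L'.residents D home w s).card := by
    intro s
    rw [hvoters, hres]
    simp only [hX]
    split_ifs with h1 h2
    · have := voteCredit_add_of_lt h1
      omega
    · have := voteCredit_add_of_lt_of_le h2 (not_lt.1 h1)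
      have := Finset.card_union_le (L.voters D home w s) (L.residents D home w s)
      omega
    · have := voteCredit_add_of_le (x := (L.residents D home l s).card) (not_lt.1 h2)
      simpa using this
  have hmove : migrationCost (L.config D home β) (L'.config D home β) ≤
      (Finset.univ.biUnion X).card := by
    refine migrationCost_le_of_eq _ _ fun v hv => ?_
    have hvX : ∀ s, v ∉ X s := by
      intro s hs
      exact hv (Finset.mem_biUnion.2 ⟨s, Finset.mem_univ s, hs⟩)
    by_cases hvw : L.rep v = w
    · have hvw' : L'.rep v = w := rep_merge_eq_iff.2 (Or.inl hvw)
      refine config_eq_config β (hvw'.trans hvw.symm) (by rwa [hvw]) (by rwa [hvw]) (hlabel v) ?_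
      intro u hu
      have hmem := mem_voters_or_residents (home := home) hu
      have := hvX (home u)
      simp only [hX] at this
      rw [hvw] at hmem ⊢
      rw [InBlob, InBlob, hvoters, hres]
      refine ⟨fun h => by omega, fun h => ?_⟩
      by_contra h'
      rw [if_neg h', if_pos h, Finset.mem_union] at this
      exact this hmem
    · by_cases hvl' : L.rep v = l
      · have hvw' : L'.rep v = w := rep_merge_eq_iff.2 (Or.inr hvl')
        have hlab := label_of_lt (hlt v hvl')
        rw [config_of_not_inBlob β (by rwa [hvl']) hlab, config_of_not_inBlob β (by rwa [hvw'])
          ((hlabel v).trans hlab)]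
        · rw [hvw', InBlob, hvoters, hres]
          intro h
          have := hvX (home v)
          simp only [hX] at this
          rw [if_pos h] at this
          exact this (by simp [residents, hvl', hlt v hvl'])
        · rw [hvl', InBlob, hvl, Finset.card_empty, threshold_zero]
          have : 0 < (L.residents D home l (home v)).card :=
            Finset.card_pos.2 ⟨v, by simp [residents, hvl', hlt v hvl']⟩
          omega
      · refine config_merge_of_notMem β ?_
        simp [cls, hvw, hvl']
  have hsum := Finset.sum_le_sum fun s (_ : s ∈ Finset.univ) => hXc s
  rw [Finset.sum_add_distrib] at hsum
  have hunion := Finset.card_biUnion_le (s := Finset.univ) (t := X)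
  rw [hcl]
  unfold credit
  unfold Big at hbig hbig'
  rw [if_neg hbig, if_neg hbig', hm]
  omega

theorem migrationCost_merge [Fintype S] (β : V → S) (hkD : k ≤ D * D) (hD : 0 < D)
    (hwl : w ≠ l) (hle : (L.tight D l).card ≤ (L.tight D w).card)
    (hcls : ((L.merge D w l).cls w).card ≤ k) :
    migrationCost (L.config D home β) ((L.merge D w l).config D home β) +
      L.potential D home k ≤ (L.merge D w l).potential D home k := by
  refine potential_le_of_agreeOn₂ hwl (fun t htw htl => agreeOn_merge htw htl) ?_ rfl
  refine le_trans ?_ (Nat.le_add_right _ _)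
  by_cases hbig : L.Big D w
  · exact migrationCost_merge_of_big β hkD hD hwl hcls hbig
  · by_cases hne : (L.tight D l).Nonempty
    · exact migrationCost_merge_of_nonempty β hkD hwl hle hbig hne
    · exact migrationCost_merge_of_empty β hD hwl hbig hne

end Merge

end LearnState

end BalancedPartitioning

/-! ### The reaction to one request and its cost. -/

namespace BalancedPartitioning

theorem communicationCost_mk {V S : Type*} [DecidableEq S] (c : Config V S) (p q : V) :
    communicationCost c s(p, q) = if c p = c q then 0 else 1 := by
  simp [communicationCost]

namespace LearnState

variable {V S : Type*} [Fintype V] [DecidableEq V] [DecidableEq S]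

section Step

variable (D : ℕ) (home : V → S) (L : LearnState V) (p q : V)

/-- The components of `p` and `q` are merged. -/
def link : LearnState V :=
  if L.rep p = L.rep q then L
  else if (L.tight D (L.rep q)).card ≤ (L.tight D (L.rep p)).card then
    L.merge D (L.rep p) (L.rep q)
  else L.merge D (L.rep q) (L.rep p)

/-- The reaction to a request between two processes of the same component. -/
def serve : LearnState V :=
  if D ≤ (L.tight D (L.rep p)).card then L
  else
    match L.label D p, L.label D q with
    | none, none => L
    | none, some u => L.setVote p u
    | some u, none => L.setVote q u
    | some u, some u' => if home u = home u' then L else L.penalize D (L.rep p) u u'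

/-- The reaction to a request between two processes. -/
def step : LearnState V := (L.link D p q).serve D home p q

end Step

/-- Votes are for processes of the same component that are not tight, and charges are less than
`2 * D`. -/
structure Valid (D : ℕ) (L : LearnState V) : Prop where
  charge_lt : ∀ v, L.charge v < 2 * D
  vote : ∀ v u, L.vote v = some u → L.rep u = L.rep v ∧ L.charge u < D

variable {D k : ℕ} {home : V → S} {L L' : LearnState V} {p q : V}

omit [Fintype V] [DecidableEq V] in
theorem Valid.label (h : L.Valid D) {v u : V} (hv : L.label D v = some u) :
    L.rep u = L.rep v ∧ L.charge u < D := by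
  rcases Nat.lt_or_ge (L.charge v) D with hc | hc
  · rw [label_of_lt hc] at hv
    obtain rfl := Option.some_injective _ hv
    exact ⟨rfl, hc⟩
  · rw [label_of_le hc] at hv
    exact h.vote v u hv

omit [Fintype V] [DecidableEq V] in
theorem le_charge_of_label_none {v : V} (h : L.label D v = none) : D ≤ L.charge v := by
  by_contra hc
  rw [label_of_lt (not_le.1 hc)] at h
  simp at h

omit [Fintype V] [DecidableEq V] in
theorem vote_of_label_none {v : V} (h : L.label D v = none) : L.vote v = none := by
  rwa [label_of_le (le_charge_of_label_none h)] at h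

/-- The possible reactions to a request between two processes of the same component. -/
inductive ServeCase (D : ℕ) (home : V → S) (L : LearnState V) (p q : V) : LearnState V → Prop
  | big (h : L.Big D (L.rep p)) : ServeCase D home L p q L
  | same (h : (L.label D p).map home = (L.label D q).map home) : ServeCase D home L p q L
  | vote_left (u : V) (hbig : ¬ L.Big D (L.rep p)) (hp : L.label D p = none)
      (hq : L.label D q = some u) : ServeCase D home L p q (L.setVote p u)
  | vote_right (u : V) (hbig : ¬ L.Big D (L.rep p)) (hp : L.label D p = some u)
      (hq : L.label D q = none) : ServeCase D home L p q (L.setVote q u)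
  | conflict (u u' : V) (hbig : ¬ L.Big D (L.rep p)) (hp : L.label D p = some u)
      (hq : L.label D q = some u') (hne : home u ≠ home u') :
      ServeCase D home L p q (L.penalize D (L.rep p) u u')

theorem serveCase : ServeCase D home L p q (L.serve D home p q) := by
  unfold serve
  split_ifs with hbig
  · exact .big hbig
  · rcases hp : L.label D p with _ | u <;> rcases hq : L.label D q with _ | u'
    · exact .same (by rw [hp, hq])
    · exact .vote_left u' hbig hp hq
    · exact .vote_right u hbig hp hq
    · dsimp only
      split_ifs with h
      · exact .same (by simp [hp, hq, h])
      · exact .conflict u u' hbig hp hq h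

omit [Fintype V] in
theorem valid_setVote (h : L.Valid D) {p u : V} (hu : L.rep u = L.rep p)
    (hc : L.charge u < D) : (L.setVote p u).Valid D where
  charge_lt := h.charge_lt
  vote v w hw := by
    by_cases hv : v = p
    · subst hv
      have : u = w := by simpa [setVote] using hw
      subst this
      exact ⟨hu, hc⟩
    · exact h.vote v w (by simpa [setVote, hv] using hw)

/-- A charged process has charge below D and receives m + 1 ≤ D. Surviving votes are for processes
of other components, whose charges are unchanged. -/
theorem valid_penalize (h : L.Valid D) {r u u' : V} (hbig : ¬ L.Big D r)
    (hu : L.rep u = r) (hu' : L.rep u' = r) (hc : L.charge u < D) (hc' : L.charge u' < D) :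
    (L.penalize D r u u').Valid D where
  charge_lt v := by
    unfold Big at hbig
    simp only [penalize]
    split_ifs with hv
    · rcases hv with rfl | rfl <;> omega
    · exact h.charge_lt v
  vote v w hw := by
    simp only [penalize] at hw ⊢
    split_ifs at hw with hv
    obtain ⟨h1, h2⟩ := h.vote v w hw
    refine ⟨h1, ?_⟩
    rw [if_neg]
    · exact h2
    · rintro (rfl | rfl)
      · exact hv (h1.symm.trans hu)
      · exact hv (h1.symm.trans hu')

theorem valid_merge (h : L.Valid D) (w l : V) : (L.merge D w l).Valid D where
  charge_lt := h.charge_lt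
  vote v u hu := by
    simp only [merge] at hu ⊢
    split_ifs at hu with hv
    obtain ⟨h1, h2⟩ := h.vote v u hu
    exact ⟨by rw [h1], h2⟩

theorem valid_link (h : L.Valid D) : (L.link D p q).Valid D := by
  unfold link
  split_ifs
  · exact h
  · exact valid_merge h _ _
  · exact valid_merge h _ _

theorem valid_serve (h : L.Valid D) (hpq : L.rep p = L.rep q) : (L.serve D home p q).Valid D := by
  have hs := serveCase (D := D) (home := home) (L := L) (p := p) (q := q)
  generalize L.serve D home p q = L' at hs
  cases hs with
  | big _ => exact h
  | same _ => exact h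
  | vote_left u hbig hp hq =>
    exact valid_setVote h ((h.label hq).1.trans hpq.symm) (h.label hq).2
  | vote_right u hbig hp hq =>
    exact valid_setVote h ((h.label hp).1.trans hpq) (h.label hp).2
  | conflict u u' hbig hp hq hne =>
    exact valid_penalize h hbig (h.label hp).1 ((h.label hq).1.trans hpq.symm) (h.label hp).2
      (h.label hq).2

theorem rep_link : (L.link D p q).rep p = (L.link D p q).rep q := by
  unfold link
  split_ifs with h1 h2
  · exact h1
  · exact (rep_merge_eq_iff.2 (Or.inl rfl)).trans (rep_merge_eq_iff.2 (Or.inr rfl)).symm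
  · exact (rep_merge_eq_iff.2 (Or.inr rfl)).trans (rep_merge_eq_iff.2 (Or.inl rfl)).symm

theorem rep_serve : (L.serve D home p q).rep = L.rep := by
  have hs := serveCase (D := D) (home := home) (L := L) (p := p) (q := q)
  generalize L.serve D home p q = L' at hs
  cases hs <;> rfl

theorem valid_step (h : L.Valid D) : (L.step D home p q).Valid D :=
  valid_serve (valid_link h) rep_link

/-- Every component is placed on one server by `g`. -/
def Respects (L : LearnState V) (g : V → S) : Prop := ∀ u v, L.rep u = L.rep v → g u = g v

omit [DecidableEq S] in
theorem respects_merge {g : V → S} (h : L.Respects g) (hpq : g p = g q) :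
    (L.merge D (L.rep p) (L.rep q)).Respects g := by
  intro u v huv
  simp only [merge] at huv
  split_ifs at huv with hu hv hv
  · exact (h u q hu).trans (h v q hv).symm
  · exact ((h u q hu).trans hpq.symm).trans (h p v huv)
  · exact ((h u p huv).trans hpq).trans (h v q hv).symm
  · exact h u v huv

omit [DecidableEq S] in
theorem respects_link {g : V → S} (h : L.Respects g) (hpq : g p = g q) :
    (L.link D p q).Respects g := by
  unfold link
  split_ifs
  · exact h
  · exact respects_merge h hpq
  · exact respects_merge h hpq.symm

theorem respects_step {g : V → S} (h : L.Respects g) (hpq : g p = g q) :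
    (L.step D home p q).Respects g := by
  have := respects_link (D := D) h hpq
  unfold Respects step at *
  rwa [rep_serve]

theorem card_cls_le {g : V → S} (h : L.Respects g) (hg : ∀ s, load g s ≤ k) (r : V) :
    (L.cls r).card ≤ k := by
  rcases (L.cls r).eq_empty_or_nonempty with h0 | ⟨v, hv⟩
  · simp [h0]
  · refine le_trans (Finset.card_le_card fun u hu => ?_) (hg (g v))
    simp only [cls, Finset.mem_filter, Finset.mem_univ, true_and] at hu hv ⊢
    exact h u v (hu.trans hv.symm)

theorem config_eq_of_label (hpq : L.rep p = L.rep q)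
    (h : L.Big D (L.rep p) ∨ (L.label D p).map home = (L.label D q).map home) (β : V → S) :
    L.config D home β p = L.config D home β q := by
  by_cases hbig : L.Big D (L.rep p)
  · rw [config_of_big β hbig, config_of_big β (by rwa [← hpq]), hpq]
  · have h := h.resolve_left hbig
    rcases hp : L.label D p with _ | u <;> rcases hq : L.label D q with _ | u'
    · rw [config_of_label_none β hp, config_of_label_none β hq, hpq]
    · simp [hp, hq] at h
    · simp [hp, hq] at h
    · have hu : home u = home u' := by simpa [hp, hq] using h
      by_cases hb : L.InBlob D home (L.rep p) (home u)
      · rw [config_of_inBlob β hp hb, config_of_inBlob β hq (by rwa [← hpq, ← hu]), hpq]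
      · rw [config_of_not_inBlob β hbig hp hb,
          config_of_not_inBlob β (by rwa [← hpq]) hq (by rwa [← hpq, ← hu]), hu]

theorem migrationCost_link [Fintype S] (β : V → S) (hkD : k ≤ D * D) (hD : 0 < D)
    (hcls : ∀ r, ((L.link D p q).cls r).card ≤ k) :
    migrationCost (L.config D home β) ((L.link D p q).config D home β) +
      L.potential D home k ≤ (L.link D p q).potential D home k := by
  unfold link at *
  split_ifs at * with h1 h2
  · simp [migrationCost_self]
  · exact migrationCost_merge β hkD hD h1 h2 (hcls _)
  · exact migrationCost_merge β hkD hD (Ne.symm h1) (by omega) (hcls _)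

/-- The migration is measured with the blobs fixed at `β`; the request is served after rebalancing,
at `β'`. Wherever the blobs lie, only a conflict can leave the two ends apart. -/
theorem cost_serve [Fintype S] (h : L.Valid D) (hpq : L.rep p = L.rep q) (hkD : k ≤ D * D)
    (β β' : V → S) :
    migrationCost (L.config D home β) ((L.serve D home p q).config D home β) +
      communicationCost ((L.serve D home p q).config D home β') s(p, q) +
      L.potential D home k ≤ (L.serve D home p q).potential D home k := by
  have hs := serveCase (D := D) (home := home) (L := L) (p := p) (q := q)
  generalize L.serve D home p q = L' at hs
  rw [communicationCost_mk]
  cases hs with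
  | big hb => simp [migrationCost_self, config_eq_of_label hpq (Or.inl hb) β']
  | same hl => simp [migrationCost_self, config_eq_of_label hpq (Or.inr hl) β']
  | vote_left u hbig hp hq =>
    have hne : q ≠ p := by
      rintro rfl
      simp [hp] at hq
    rw [if_pos, Nat.add_zero]
    · exact migrationCost_setVote β (le_charge_of_label_none hp) (vote_of_label_none hp) hbig
    · refine config_eq_of_label (L := L.setVote p u) hpq (Or.inr ?_) β'
      rw [label_setVote_self (le_charge_of_label_none hp), label_setVote_of_ne hne, hq]
  | vote_right u hbig hp hq =>
    have hne : p ≠ q := by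
      rintro rfl
      simp [hp] at hq
    rw [if_pos, Nat.add_zero]
    · exact migrationCost_setVote β (le_charge_of_label_none hq) (vote_of_label_none hq)
        (by rwa [← hpq])
    · refine config_eq_of_label (L := L.setVote q u) hpq (Or.inr ?_) β'
      rw [label_setVote_self (le_charge_of_label_none hq), label_setVote_of_ne hne, hp]
  | conflict u u' hbig hp hq hne =>
    have huu' : u ≠ u' := fun h => hne (by rw [h])
    have := migrationCost_penalize (k := k) (home := home) β hkD huu' (h.label hp).1
      ((h.label hq).1.trans hpq.symm) hbig
    split_ifs <;> omega

theorem cost_step [Fintype S] (h : L.Valid D) (hkD : k ≤ D * D) (hD : 0 < D)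
    (hcls : ∀ r, ((L.step D home p q).cls r).card ≤ k) (β β' : V → S) :
    migrationCost (L.config D home β) ((L.step D home p q).config D home β) +
      communicationCost ((L.step D home p q).config D home β') s(p, q) +
      L.potential D home k ≤ (L.step D home p q).potential D home k := by
  have hcls' : ∀ r, ((L.link D p q).cls r).card ≤ k := by
    intro r
    have := hcls r
    unfold cls step at this
    rwa [rep_serve] at this
  have h1 := migrationCost_link (home := home) β hkD hD hcls'
  have h2 := cost_serve (home := home) (valid_link h) (rep_link (L := L) (D := D) (p := p) (q := q))
    hkD β β'
  have h3 := migrationCost_triangle (L.config D home β) ((L.link D p q).config D home β)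
    ((L.step D home p q).config D home β)
  unfold step at *
  omega

/-- The processes outside the blobs occupy every server at most twice as much as at home. -/
theorem card_not_gathered_le (hk : ∀ s, load home s ≤ k) (s : S) [DecidablePred fun v =>
      ¬ L.Gathered D home v ∧ L.base D home v = s] :
    (Finset.univ.filter fun v => ¬ L.Gathered D home v ∧ L.base D home v = s).card ≤ 2 * k := by
  set Y : V → Finset V := fun r =>
    if (L.residents D home r s).card < threshold (L.voters D home r s).card then ∅
    else L.voters D home r s ∪ L.residents D home r s with hY
  have hYc : ∀ r, (Y r).card ≤ 2 * (L.residents D home r s).card := by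
    intro r
    simp only [hY]
    split_ifs with h
    · simp
    -- Outside the blob, voters < threshold ≤ residents, so the group is at most twice its
    -- residents.
    · have := lt_threshold (L.voters D home r s).card
      have := Finset.card_union_le (L.voters D home r s) (L.residents D home r s)
      omega
  have hsub : (Finset.univ.filter fun v => ¬ L.Gathered D home v ∧ L.base D home v = s) ⊆
      Finset.univ.biUnion Y := by
    intro v hv
    rw [Finset.mem_filter] at hv
    simp only [Finset.mem_univ, true_and, Gathered, not_or, not_forall] at hv
    obtain ⟨⟨_, u, hu, hb⟩, hs⟩ := hv
    have hs' : home u = s := by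
      rw [← hs, base, hu]
      rfl
    refine Finset.mem_biUnion.2 ⟨L.rep v, Finset.mem_univ _, ?_⟩
    have := mem_voters_or_residents (home := home) hu
    unfold InBlob at hb
    rw [hs'] at this hb
    simp only [hY]
    rwa [if_neg hb, Finset.mem_union]
  have hsum : ∑ r, (L.residents D home r s).card ≤ load home s := by
    rw [← Finset.card_biUnion]
    · refine Finset.card_le_card fun v hv => ?_
      simp only [residents, Finset.mem_biUnion, Finset.mem_filter, Finset.mem_univ,
        true_and] at hv ⊢
      obtain ⟨_, _, _, h⟩ := hv
      exact h
    · intro r _ t _ hrt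
      rw [Function.onFun, Finset.disjoint_left]
      intro v hv hv'
      simp only [residents, Finset.mem_filter, Finset.mem_univ, true_and] at hv hv'
      exact hrt (hv.1.symm.trans hv'.1)
  calc _ ≤ (Finset.univ.biUnion Y).card := Finset.card_le_card hsub
    _ ≤ ∑ r, (Y r).card := Finset.card_biUnion_le
    _ ≤ ∑ r, 2 * (L.residents D home r s).card := Finset.sum_le_sum fun r _ => hYc r
    _ = 2 * ∑ r, (L.residents D home r s).card := (Finset.mul_sum _ _ _).symm
    _ ≤ 2 * k := Nat.mul_le_mul_left _ (hsum.trans (hk s))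

theorem exists_rebalance [Fintype S] (hk : ∀ s, load home s ≤ k)
    (hcls : ∀ r, (L.cls r).card ≤ k) {ε : ℝ} (hε : 0 < ε) (β : V → S) :
    ∃ β' : V → S, (∀ s, (load (L.config D home β') s : ℝ) ≤ (2 + ε) * k) ∧
      (migrationCost (L.config D home β) (L.config D home β') : ℝ) +
        (2 + ε) / ε * excess k (L.config D home β') ≤
        (2 + ε) / ε * excess k (L.config D home β) := by
  classical
  refine BalancedPartitioning.exists_rebalance (card_le_of_load_le hk) (fun r => ?_)
    (fun s => ?_) hε β
  · refine le_trans (Finset.card_le_card fun v hv => ?_) (hcls r)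
    simp only [cls, Finset.mem_filter, Finset.mem_univ, true_and] at hv ⊢
    exact hv.2
  · exact card_not_gathered_le hk s

/-- The m tight processes of a component carry charge at least D·m. This bounds m, and for a big
component also k and with it the size term. The factor 91 is 81 for the credits plus 10 for the
charges. -/
theorem potential_le [Fintype S] (hkD : k ≤ D * D) (hD : 0 < D)
    (hcls : ∀ r, (L.cls r).card ≤ k) : L.potential D home k ≤ 91 * ∑ v, L.charge v := by
  have hcredit : ∀ r, L.credit D home k r ≤ 81 * ∑ v ∈ L.cls r, L.charge v := by
    intro r
    have hc : D * (L.tight D r).card ≤ ∑ v ∈ L.cls r, L.charge v := by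
      refine le_trans ?_ (Finset.sum_le_sum_of_subset (tight_subset_cls (D := D)))
      rw [mul_comm, ← smul_eq_mul]
      refine Finset.card_nsmul_le_sum _ _ _ fun v hv => ?_
      simp only [tight, Finset.mem_filter, Finset.mem_univ, true_and] at hv
      exact hv.2
    by_cases hbig : L.Big D r
    · rw [credit_of_big hbig]
      have h1 : k ≤ D * (L.tight D r).card := hkD.trans (Nat.mul_le_mul_left _ hbig)
      have := hcls r
      omega
    · have h1 := credit_le_of_not_big (home := home) (k := k) hbig
      have h2 : D * ((L.tight D r).card - 1) ≤ D * (L.tight D r).card :=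
        Nat.mul_le_mul_left _ (by omega)
      have h3 : (L.tight D r).card ≤ D * (L.tight D r).card := Nat.le_mul_of_pos_left _ hD
      omega
  have hsum : ∑ r, ∑ v ∈ L.cls r, L.charge v = ∑ v, L.charge v := by
    unfold cls
    exact Finset.sum_fiberwise _ _ _
  have := Finset.sum_le_sum fun r (_ : r ∈ Finset.univ) => hcredit r
  rw [← Finset.mul_sum, hsum] at this
  unfold potential
  omega

/-! ### Charges against the cost of an offline solution. -/

/-- The charges are related to the cost `o` of an offline solution that is in configuration `y`:
`M` contains the processes that it has moved so far, `R` the components in which it has spent cost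
since the last conflict, and `N` is the number of conflicts in such components. -/
structure Accounts (D : ℕ) (home : V → S) (L : LearnState V) (y : Config V S) (M R : Finset V)
    (N o : ℕ) : Prop where
  moved : ∀ v, v ∉ M → y v = home v
  clean : ∀ v u, L.rep v ∉ R → L.label D v = some u → u ∈ M ∨ y v = home u
  card_moved : M.card ≤ o
  card_dirty : R.card + N ≤ o
  charge : ∑ v, L.charge v ≤ 2 * (D * N) + 2 * ∑ v ∈ M, L.charge v

namespace Accounts

variable {y y' : Config V S} {M R : Finset V} {N o : ℕ}

/-- Each offline migration is used twice, for `card_moved` and for `card_dirty`; these are separate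
bounds by the same cost. -/
theorem move (h : Accounts D home L y M R N o) (y' : Config V S) :
    ∃ M' R', Accounts D home L y' M' R' N (o + migrationCost y y') := by
  set X := Finset.univ.filter fun v => y v ≠ y' v with hX
  have hXc : X.card = migrationCost y y' := rfl
  have hy : ∀ v, v ∉ X → y v = y' v := by
    intro v hv
    simpa [hX] using hv
  refine ⟨M ∪ X, R ∪ X.image L.rep, ?_, ?_, ?_, ?_, ?_⟩
  · intro v hv
    rw [Finset.mem_union, not_or] at hv
    rw [← hy v hv.2, h.moved v hv.1]
  · intro v u hv hu
    rw [Finset.mem_union, not_or] at hv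
    have hvX : v ∉ X := fun hvX => hv.2 (Finset.mem_image_of_mem _ hvX)
    rw [← hy v hvX, Finset.mem_union]
    exact (h.clean v u hv.1 hu).imp_left Or.inl
  · rw [← hXc]
    exact (Finset.card_union_le _ _).trans (Nat.add_le_add_right h.card_moved _)
  · have h1 := Finset.card_union_le R (X.image L.rep)
    have h2 := Finset.card_image_le (s := X) (f := L.rep)
    have := h.card_dirty
    omega
  · refine h.charge.trans (Nat.add_le_add_left (Nat.mul_le_mul_left _ ?_) _)
    exact Finset.sum_le_sum_of_subset Finset.subset_union_left

-- The merged component is dirty if one of its parts was; deleting votes leaves fewer labels to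
-- check in `clean`.
omit [DecidableEq S] in
theorem merge (h : Accounts D home L y M R N o) (w l : V) :
    Accounts D home (L.merge D w l) y M (R.image fun r => if r = l then w else r) N o where
  moved := h.moved
  clean v u hv hu := by
    refine h.clean v u (fun hr => hv ?_) ?_
    · exact Finset.mem_image_of_mem (fun r => if r = l then w else r) hr
    · rcases Nat.lt_or_ge (L.charge v) D with hc | hc
      · rw [label_of_lt (L := L.merge D w l) hc] at hu
        rw [label_of_lt hc, hu]
      · rw [label_of_le (L := L.merge D w l) hc] at hu
        simp only [LearnState.merge] at hu
        split_ifs at hu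
        rw [label_of_le hc, hu]
  card_moved := h.card_moved
  card_dirty := (Nat.add_le_add_right Finset.card_image_le _).trans h.card_dirty
  charge := h.charge

omit [DecidableEq S] in
theorem link (h : Accounts D home L y M R N o) (p q : V) :
    ∃ R', Accounts D home (L.link D p q) y M R' N o := by
  unfold LearnState.link
  split_ifs
  · exact ⟨_, h⟩
  · exact ⟨_, h.merge _ _⟩
  · exact ⟨_, h.merge _ _⟩

theorem communicate (h : Accounts D home L y M R N o) (p q : V) :
    ∃ R', Accounts D home L y M R' N (o + communicationCost y s(p, q)) ∧
      (L.rep p ∉ R' → y p = y q) := by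
  rw [communicationCost_mk]
  split_ifs with hpq
  · exact ⟨R, h, fun _ => hpq⟩
  · refine ⟨insert (L.rep p) R, ⟨h.moved, fun v u hv hu => ?_, ?_, ?_, h.charge⟩, fun hp => ?_⟩
    · exact h.clean v u (fun hr => hv (Finset.mem_insert_of_mem hr)) hu
    · exact h.card_moved.trans (Nat.le_succ _)
    · have := Finset.card_insert_le (L.rep p) R
      have := h.card_dirty
      omega
    · exact absurd (Finset.mem_insert_self _ _) hp

omit [DecidableEq S] in
theorem setVote (h : Accounts D home L y M R N o) {p u : V} (hp : L.label D p = none)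
    (hu : L.rep p ∉ R → u ∈ M ∨ y p = home u) :
    Accounts D home (L.setVote p u) y M R N o where
  moved := h.moved
  clean v w hv hw := by
    by_cases hvp : v = p
    · subst hvp
      rw [label_setVote_self (le_charge_of_label_none hp)] at hw
      obtain rfl := Option.some_injective _ hw
      exact hu hv
    · rw [label_setVote_of_ne hvp] at hw
      exact h.clean v w hv hw
  card_moved := h.card_moved
  card_dirty := h.card_dirty
  charge := h.charge

-- If `r` is dirty, deleting its votes makes it clean, so it passes from `R` to the count `N`; the
-- total charge grows by 2(m + 1) ≤ 2D. If it is clean, `hM` puts at least half of the added charge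
-- on `M`.
omit [DecidableEq S] in
theorem penalize (h : Accounts D home L y M R N o) {r u u' : V} (huu' : u ≠ u')
    (hu : L.rep u = r) (hu' : L.rep u' = r) (hbig : ¬ L.Big D r)
    (hM : r ∉ R → u ∈ M ∨ u' ∈ M) :
    ∃ R' N', Accounts D home (L.penalize D r u u') y M R' N' o := by
  have hclean : ∀ v w, L.rep v ∉ R.erase r → (L.penalize D r u u').label D v = some w →
      w ∈ M ∨ y v = home w := by
    intro v w hv hw
    by_cases hr : L.rep v = r
    · rcases Nat.lt_or_ge ((L.penalize D r u u').charge v) D with hc | hc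
      · rw [label_of_lt hc] at hw
        obtain rfl := Option.some_injective _ hw
        by_cases hvM : v ∈ M
        · exact Or.inl hvM
        · exact Or.inr (h.moved v hvM)
      · rw [label_of_le hc] at hw
        simp [LearnState.penalize, hr] at hw
    · rw [(agreeOn_penalize hu hu' hr).label rfl] at hw
      exact h.clean v w (fun h' => hv (Finset.mem_erase.2 ⟨hr, h'⟩)) hw
  have hch := h.charge
  have hd := h.card_dirty
  unfold Big at hbig
  by_cases hr : r ∈ R
  · refine ⟨R.erase r, N + 1, h.moved, hclean, h.card_moved, ?_, ?_⟩
    · have := Finset.card_erase_add_one hr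
      omega
    · rw [sum_charge_penalize, sum_charge_penalize, card_filter_eq_or_eq huu', Nat.mul_add D]
      omega
  · refine ⟨R, N, h.moved, ?_, h.card_moved, hd, ?_⟩
    · rwa [Finset.erase_eq_of_notMem hr] at hclean
    · rw [sum_charge_penalize, sum_charge_penalize, card_filter_eq_or_eq huu']
      have : 1 ≤ (M.filter fun v => v = u ∨ v = u').card := by
        refine Finset.card_pos.2 ?_
        rcases hM hr with hM | hM
        · exact ⟨u, by simp [hM]⟩
        · exact ⟨u', by simp [hM]⟩
      have := Nat.mul_le_mul_right ((L.tight D r).card + 1) this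
      omega

theorem serve (h : Accounts D home L y M R N o) (hL : L.Valid D) (hpq : L.rep p = L.rep q)
    (hy : L.rep p ∉ R → y p = y q) :
    ∃ R' N', Accounts D home (L.serve D home p q) y M R' N' o := by
  have hs := serveCase (D := D) (home := home) (L := L) (p := p) (q := q)
  generalize L.serve D home p q = L' at hs
  cases hs with
  | big _ => exact ⟨R, N, h⟩
  | same _ => exact ⟨R, N, h⟩
  | vote_left u hbig hp hq =>
    refine ⟨R, N, h.setVote hp fun hr => ?_⟩
    rw [hy hr]
    exact h.clean q u (by rwa [← hpq]) hq
  | vote_right u hbig hp hq =>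
    refine ⟨R, N, h.setVote hq fun hr => ?_⟩
    rw [← hpq] at hr
    rw [← hy hr]
    exact h.clean p u hr hp
  | conflict u u' hbig hp hq hne =>
    refine h.penalize (fun h => hne (by rw [h])) (hL.label hp).1
      ((hL.label hq).1.trans hpq.symm) hbig fun hr => ?_
    rcases h.clean p u hr hp with hM | h1
    · exact Or.inl hM
    · rcases h.clean q u' (by rwa [← hpq]) hq with hM | h2
      · exact Or.inr hM
      -- If neither `u` nor `u'` were moved, both labels would be true: home u = y p = y q = home
      -- u', contrary to the conflict.
      · exact absurd (h1.symm.trans ((hy hr).trans h2)) hne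

theorem step (h : Accounts D home L y M R N o) (hL : L.Valid D) (y' : Config V S) (p q : V) :
    ∃ M' R' N', Accounts D home (L.step D home p q) y' M' R' N'
      (o + (migrationCost y y' + communicationCost y' s(p, q))) := by
  obtain ⟨M₁, R₁, h₁⟩ := h.move y'
  obtain ⟨R₂, h₂⟩ := h₁.link p q
  obtain ⟨R₃, h₃, hy⟩ := h₂.communicate p q
  obtain ⟨R₄, N₄, h₄⟩ := h₃.serve (valid_link hL) rep_link hy
  rw [Nat.add_assoc] at h₄
  exact ⟨_, _, _, h₄⟩

-- At most o moved processes carry charge below 2D each, and N ≤ o: 2·D·o + 2·(2·D·o) = 6·D·o.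
omit [DecidableEq V] [DecidableEq S] in
theorem sum_charge_le (h : Accounts D home L y M R N o) (hL : L.Valid D) :
    ∑ v, L.charge v ≤ 6 * (D * o) := by
  have h1 : ∑ v ∈ M, L.charge v ≤ M.card * (2 * D) := by
    rw [← smul_eq_mul]
    exact Finset.sum_le_card_nsmul _ _ _ fun v _ => (hL.charge_lt v).le
  have h2 : D * N ≤ D * o := Nat.mul_le_mul_left _ (by have := h.card_dirty; omega)
  have h3 : M.card * (2 * D) ≤ 2 * (D * o) := by
    calc M.card * (2 * D) ≤ o * (2 * D) := Nat.mul_le_mul_right _ h.card_moved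
      _ = 2 * (D * o) := by ring
  have := h.charge
  omega

end Accounts

end LearnState

end BalancedPartitioning

/-! ### The online algorithm, its augmentation and its competitive ratio. -/

namespace BalancedPartitioning

theorem cost_nil {V S : Type*} [Fintype V] [DecidableEq S] (x : ℕ → Config V S) :
    cost x [] = 0 := by
  simp [cost]

theorem cost_concat {V S : Type*} [Fintype V] [DecidableEq S] (x : ℕ → Config V S)
    (σ : List (Sym2 V)) (r : Sym2 V) :
    cost x (σ ++ [r]) = cost x σ + (migrationCost (x σ.length) (x (σ.length + 1)) +
      communicationCost (x (σ.length + 1)) r) := by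
  have hlen : σ.length + 1 = (σ ++ [r]).length := by simp
  unfold cost
  rw [← Equiv.sum_comp (finCongr hlen), Fin.sum_univ_castSucc]
  congr 1
  · refine Finset.sum_congr rfl fun t _ => ?_
    simp
  · simp

theorem cost_congr {V S : Type*} [Fintype V] [DecidableEq S] {x y : ℕ → Config V S}
    {σ : List (Sym2 V)} (h : ∀ t ≤ σ.length, x t = y t) : cost x σ = cost y σ := by
  unfold cost
  refine Finset.sum_congr rfl fun t _ => ?_
  rw [h t t.2.le, h (t + 1) t.2]

namespace LearnState

variable {V S : Type*} [Fintype V] [DecidableEq V] [Fintype S] [DecidableEq S]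

/-- Every process forms its own component and nothing has been charged. -/
def init (V : Type*) : LearnState V where
  rep := id
  charge := fun _ => 0
  vote := fun _ => none

section Algorithm

variable (D k : ℕ) (ε : ℝ) (home : V → S)

open Classical in
/-- The placement of the blobs after those on overfull servers have been moved. -/
noncomputable def rebalance (L : LearnState V) (β : V → S) : V → S :=
  if h : ∃ β' : V → S, (∀ s, (load (L.config D home β') s : ℝ) ≤ (2 + ε) * k) ∧
      (migrationCost (L.config D home β) (L.config D home β') : ℝ) +
        (2 + ε) / ε * excess k (L.config D home β') ≤
        (2 + ε) / ε * excess k (L.config D home β) then h.choose else β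

/-- The state of the algorithm after one more request. -/
noncomputable def advance (X : LearnState V × (V → S)) (r : Sym2 V) : LearnState V × (V → S) :=
  (X.1.step D home r.out.1 r.out.2,
    rebalance D k ε home (X.1.step D home r.out.1 r.out.2) X.2)

/-- The state of the algorithm after the requests of `τ`. -/
noncomputable def state (τ : List (Sym2 V)) : LearnState V × (V → S) :=
  τ.foldl (advance D k ε home) (init V, home)

theorem state_concat (τ : List (Sym2 V)) (r : Sym2 V) :
    state D k ε home (τ ++ [r]) = advance D k ε home (state D k ε home τ) r := by
  simp [state]

end Algorithm

variable {D k : ℕ} {ε : ℝ} {home : V → S}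

theorem not_big_init (hD : 0 < D) (r : V) : ¬ (init V).Big D r := by
  simp [Big, tight, init, hD.ne']

omit [Fintype S] in
theorem config_init (hD : 0 < D) : (init V).config D home home = home := by
  funext v
  exact config_eq_home_of_vote_none home (not_big_init hD _) (fun _ _ => rfl) hD

omit [Fintype V] [DecidableEq V] in
theorem valid_init (hD : 0 < D) : (init V).Valid D where
  charge_lt v := by
    simp only [init]
    omega
  vote v u h := by simp [init] at h

/-- The online algorithm. -/
noncomputable def algorithm (k : ℕ) (ε : ℝ) (home : V → S) {D : ℕ} (hD : 0 < D) :
    OnlineAlgorithm home where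
  config τ := (state D k ε home τ).1.config D home (state D k ε home τ).2
  config_nil := config_init hD

theorem run_concat (hD : 0 < D) (σ : List (Sym2 V)) (r : Sym2 V) {t : ℕ} (ht : t ≤ σ.length) :
    (algorithm k ε home hD).run (σ ++ [r]) t = (algorithm k ε home hD).run σ t := by
  unfold OnlineAlgorithm.run
  rw [List.take_append_of_le_length ht]

theorem run_length (hD : 0 < D) (σ : List (Sym2 V)) :
    (algorithm k ε home hD).run σ σ.length =
      (state D k ε home σ).1.config D home (state D k ε home σ).2 := by
  unfold OnlineAlgorithm.run
  rw [List.take_length]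
  rfl

omit [Fintype V] [DecidableEq V] [Fintype S] in
theorem eq_of_communicationCost_eq_zero {g : V → S} {r : Sym2 V}
    (h : communicationCost g r = 0) : g r.out.1 = g r.out.2 := by
  have hr : s(r.out.1, r.out.2) = r := Quot.out_eq r
  rw [← hr, communicationCost_mk] at h
  by_contra hne
  simp [hne] at h

theorem valid_state (hD : 0 < D) (σ : List (Sym2 V)) : (state D k ε home σ).1.Valid D := by
  induction σ using List.reverseRecOn with
  | nil => exact valid_init hD
  | append_singleton σ r ih =>
    rw [state_concat]
    exact valid_step ih

theorem respects_state {g : V → S} {σ : List (Sym2 V)} (h : ∀ r ∈ σ, communicationCost g r = 0) :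
    (state D k ε home σ).1.Respects g := by
  induction σ using List.reverseRecOn with
  | nil =>
    intro u v huv
    exact congrArg g huv
  | append_singleton σ r ih =>
    rw [state_concat]
    exact respects_step (ih fun t ht => h t (List.mem_append_left _ ht))
      (eq_of_communicationCost_eq_zero (h r (by simp)))

theorem rebalance_spec (hε : 0 < ε) (hk : ∀ s, load home s ≤ k) {L : LearnState V}
    (hcls : ∀ r, (L.cls r).card ≤ k) (β : V → S) :
    (∀ s, (load (L.config D home (rebalance D k ε home L β)) s : ℝ) ≤ (2 + ε) * k) ∧
      (migrationCost (L.config D home β) (L.config D home (rebalance D k ε home L β)) : ℝ) +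
        (2 + ε) / ε * excess k (L.config D home (rebalance D k ε home L β)) ≤
        (2 + ε) / ε * excess k (L.config D home β) := by
  have h := exists_rebalance (D := D) hk hcls hε β
  unfold rebalance
  rw [dif_pos h]
  exact h.choose_spec

theorem load_state_le (hD : 0 < D) (hε : 0 < ε) (hk : ∀ s, load home s ≤ k)
    {σ : List (Sym2 V)} (hσ : Learnable S k σ) (s : S) :
    (load ((state D k ε home σ).1.config D home (state D k ε home σ).2) s : ℝ) ≤
      (2 + ε) * k := by
  obtain ⟨g, hg, hr⟩ := hσ
  rcases List.eq_nil_or_concat' σ with rfl | ⟨τ, r, rfl⟩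
  · have h : (state D k ε home ([] : List (Sym2 V))).1.config D home
        (state D k ε home ([] : List (Sym2 V))).2 = home := config_init hD
    rw [h]
    have : (load home s : ℝ) ≤ k := by exact_mod_cast hk s
    nlinarith [(Nat.cast_nonneg k : (0 : ℝ) ≤ k)]
  · have hcls := card_cls_le (respects_state (D := D) (k := k) (ε := ε) (home := home) hr) hg
    rw [state_concat] at hcls ⊢
    exact (rebalance_spec hε hk hcls _).1 s

theorem hasAugmentation_algorithm (hD : 0 < D) (hε : 0 < ε) (hk : ∀ s, load home s ≤ k) :
    (algorithm k ε home hD).HasAugmentation k (2 + ε) := by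
  rintro σ ⟨g, hg, hr⟩ t _ s
  exact load_state_le hD hε hk ⟨g, hg, fun r h => hr r (List.mem_of_mem_take h)⟩ s

/-- With blobs fixed, the step costs at most the growth of the potential, and the excess grows by no
more than the migrations. Weighting excess by (2+ε)/ε pays for the rebalancing, hence the factor 1 +
(2+ε)/ε. -/
theorem cost_advance_le (hD : 0 < D) (hkD : k ≤ D * D) (hε : 0 < ε)
    (hk : ∀ s, load home s ≤ k) {X : LearnState V × (V → S)} {r : Sym2 V} (hX : X.1.Valid D)
    (hcls : ∀ t, ((advance D k ε home X r).1.cls t).card ≤ k) :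
    ((migrationCost (X.1.config D home X.2)
        ((advance D k ε home X r).1.config D home (advance D k ε home X r).2) +
      communicationCost
        ((advance D k ε home X r).1.config D home (advance D k ε home X r).2) r : ℕ) : ℝ) +
      (2 + ε) / ε * excess k
        ((advance D k ε home X r).1.config D home (advance D k ε home X r).2) +
      (1 + (2 + ε) / ε) * X.1.potential D home k ≤
      (2 + ε) / ε * excess k (X.1.config D home X.2) +
        (1 + (2 + ε) / ε) * (advance D k ε home X r).1.potential D home k := by
  have hκ : 0 ≤ (2 + ε) / ε := by positivity
  have hout : s(r.out.1, r.out.2) = r := Quot.out_eq r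
  have hreb : (migrationCost ((advance D k ε home X r).1.config D home X.2)
        ((advance D k ε home X r).1.config D home (advance D k ε home X r).2) : ℝ) +
      (2 + ε) / ε * excess k
        ((advance D k ε home X r).1.config D home (advance D k ε home X r).2) ≤
      (2 + ε) / ε * excess k ((advance D k ε home X r).1.config D home X.2) :=
    (rebalance_spec (D := D) hε hk hcls X.2).2
  have hstep := cost_step (home := home) (p := r.out.1) (q := r.out.2) hX hkD hD hcls X.2
    (advance D k ε home X r).2
  rw [hout] at hstep
  change migrationCost _ ((advance D k ε home X r).1.config D home X.2) +
    communicationCost ((advance D k ε home X r).1.config D home (advance D k ε home X r).2) r +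
    _ ≤ (advance D k ε home X r).1.potential D home k at hstep
  have hex := excess_le_add_migrationCost k (X.1.config D home X.2)
    ((advance D k ε home X r).1.config D home X.2)
  have htri := migrationCost_triangle (X.1.config D home X.2)
    ((advance D k ε home X r).1.config D home X.2)
    ((advance D k ε home X r).1.config D home (advance D k ε home X r).2)
  generalize (2 + ε) / ε = κ at *
  have hstep' := mul_le_mul_of_nonneg_left (Nat.cast_le (α := ℝ).2 hstep) (by linarith : 0 ≤ 1 + κ)
  have hex' := mul_le_mul_of_nonneg_left (Nat.cast_le (α := ℝ).2 hex) hκ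
  have htri' := Nat.cast_le (α := ℝ).2 htri
  have hcomm : 0 ≤ κ * (communicationCost ((advance D k ε home X r).1.config D home
    (advance D k ε home X r).2) r : ℝ) := mul_nonneg hκ (Nat.cast_nonneg _)
  push_cast at hstep' hex' htri' ⊢
  linarith

theorem cost_run_le (hD : 0 < D) (hkD : k ≤ D * D) (hε : 0 < ε) (hk : ∀ s, load home s ≤ k)
    {σ : List (Sym2 V)} (hσ : Learnable S k σ) :
    (cost ((algorithm k ε home hD).run σ) σ : ℝ) +
      (2 + ε) / ε * excess k ((algorithm k ε home hD).run σ σ.length) ≤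
      (1 + (2 + ε) / ε) * (state D k ε home σ).1.potential D home k := by
  induction σ using List.reverseRecOn with
  | nil =>
    have h : (algorithm k ε home hD).run ([] : List (Sym2 V)) ([] : List (Sym2 V)).length = home :=
      (algorithm k ε home hD).config_nil
    have h0 : excess k home = 0 := by
      refine Finset.sum_eq_zero fun s _ => ?_
      have := hk s
      omega
    rw [h, h0, cost_nil]
    simp only [Nat.cast_zero, mul_zero, add_zero]
    positivity
  | append_singleton σ r ih =>
    obtain ⟨g, hg, hr⟩ := hσ
    have ih := ih ⟨g, hg, fun t ht => hr t (List.mem_append_left _ ht)⟩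
    have hcls := card_cls_le (respects_state (D := D) (k := k) (ε := ε) (home := home) hr) hg
    have hrun := run_length (k := k) (ε := ε) (home := home) hD (σ ++ [r])
    rw [show (σ ++ [r]).length = σ.length + 1 by simp] at hrun ⊢
    rw [cost_concat, cost_congr fun t ht => run_concat hD σ r ht, run_concat hD σ r le_rfl, hrun,
      run_length]
    rw [run_length] at ih
    rw [state_concat] at hcls ⊢
    have := cost_advance_le hD hkD hε hk (valid_state hD σ) hcls
    push_cast at this ⊢
    linarith

theorem exists_accounts (hD : 0 < D) (x : ℕ → Config V S) (hx : x 0 = home)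
    (σ : List (Sym2 V)) :
    ∃ M R N, Accounts D home (state D k ε home σ).1 (x σ.length) M R N (cost x σ) := by
  induction σ using List.reverseRecOn with
  | nil =>
    refine ⟨∅, ∅, 0, ⟨fun v _ => by simp [hx], fun v u _ hu => Or.inr ?_, by simp, by simp, ?_⟩⟩
    · have : some v = some u := by
        rw [← hu]
        exact (label_of_lt (L := init V) hD).symm
      obtain rfl := Option.some_injective _ this
      simp [hx]
    · simp [state, init]
  | append_singleton σ r ih =>
    obtain ⟨M, R, N, h⟩ := ih
    obtain ⟨M', R', N', h'⟩ := h.step (valid_state hD σ) (x (σ.length + 1)) r.out.1 r.out.2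
    have hout : s(r.out.1, r.out.2) = r := Quot.out_eq r
    rw [hout] at h'
    refine ⟨M', R', N', ?_⟩
    rw [state_concat, cost_concat, show (σ ++ [r]).length = σ.length + 1 by simp]
    exact h'

theorem isCompetitive_algorithm (hD : 0 < D) (hkD : k ≤ D * D) (hε : 0 < ε)
    (hk : ∀ s, load home s ≤ k) :
    (algorithm k ε home hD).IsCompetitive k ((1 + (2 + ε) / ε) * (546 * D)) := by
  intro σ hσ
  have hcost := cost_run_le hD hkD hε hk hσ
  obtain ⟨x, ⟨hx, _⟩, hopt⟩ := (opt_isLeast k home hk σ).1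
  obtain ⟨M, R, N, h⟩ := exists_accounts (k := k) (ε := ε) hD x hx σ
  obtain ⟨g, hg, hr⟩ := hσ
  have hcls := card_cls_le (respects_state (D := D) (k := k) (ε := ε) (home := home) hr) hg
  have hpot := potential_le (home := home) hkD hD hcls
  have hch := h.sum_charge_le (valid_state hD σ)
  rw [hopt] at hch
  have hP : ((state D k ε home σ).1.potential D home k : ℝ) ≤ 546 * D * opt k home σ := by
    -- 546 = 91 · 6, from `potential_le` and `Accounts.sum_charge_le`.
    have : (state D k ε home σ).1.potential D home k ≤ 546 * (D * opt k home σ) := by omega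
    calc ((state D k ε home σ).1.potential D home k : ℝ)
        ≤ ((546 * (D * opt k home σ) : ℕ) : ℝ) := by exact_mod_cast this
      _ = 546 * D * opt k home σ := by push_cast; ring
  have hκ : 0 ≤ (2 + ε) / ε := by positivity
  have hex : 0 ≤ (2 + ε) / ε * (excess k ((algorithm k ε home hD).run σ σ.length) : ℝ) := by
    positivity
  calc (cost ((algorithm k ε home hD).run σ) σ : ℝ)
      ≤ (1 + (2 + ε) / ε) * (state D k ε home σ).1.potential D home k := by linarith
    _ ≤ (1 + (2 + ε) / ε) * (546 * D * opt k home σ) :=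
        mul_le_mul_of_nonneg_left hP (by linarith)
    _ = (1 + (2 + ε) / ε) * (546 * D) * opt k home σ := by ring

end LearnState

end BalancedPartitioning

theorem theorem4 :
    ∀ ε : ℝ, 0 < ε → ∃ C : ℝ, 0 < C ∧
      ∀ (k ℓ n : ℕ) (home : BalancedPartitioning.Config (Fin n) (Fin ℓ)),
        (∀ s, BalancedPartitioning.load home s ≤ k) →
        ∃ A : BalancedPartitioning.OnlineAlgorithm home,
          A.HasAugmentation k (2 + ε) ∧ A.IsCompetitive k (C * Real.sqrt k) := by
  intro ε hε
  -- 1092 = 2 · 546, since D = `Nat.sqrt k + 1` is at most 2√k for k ≥ 1.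
  refine ⟨(1 + (2 + ε) / ε) * 1092, by positivity, fun k ℓ n home hk => ?_⟩
  have hD : 0 < Nat.sqrt k + 1 := Nat.succ_pos _
  have hkD : k ≤ (Nat.sqrt k + 1) * (Nat.sqrt k + 1) := (Nat.lt_succ_sqrt k).le
  refine ⟨BalancedPartitioning.LearnState.algorithm k ε home hD,
    BalancedPartitioning.LearnState.hasAugmentation_algorithm hD hε hk, fun σ hσ => ?_⟩
  -- For k = 0 the bound D ≤ 2√k fails, but then there are no processes and hence no requests.
  rcases Nat.eq_zero_or_pos k with rfl | hk0
  · have hn : n = 0 := by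
      have := BalancedPartitioning.card_le_of_load_le hk
      simpa using this
    subst hn
    rcases σ with _ | ⟨r, σ⟩
    · simp [BalancedPartitioning.cost_nil]
    · exact r.out.1.elim0
  · refine (BalancedPartitioning.LearnState.isCompetitive_algorithm hD hkD hε hk σ hσ).trans ?_
    refine mul_le_mul_of_nonneg_right ?_ (Nat.cast_nonneg _)
    have h1 : (Nat.sqrt k : ℝ) ≤ Real.sqrt k := Real.nat_sqrt_le_real_sqrt
    have h2 : 1 ≤ Real.sqrt k := Real.one_le_sqrt.2 (by exact_mod_cast hk0)
    have h3 : ((Nat.sqrt k + 1 : ℕ) : ℝ) ≤ 2 * Real.sqrt k := by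
      push_cast
      linarith
    have h4 : 0 ≤ 1 + (2 + ε) / ε := by positivity
    calc (1 + (2 + ε) / ε) * (546 * ((Nat.sqrt k + 1 : ℕ) : ℝ))
        ≤ (1 + (2 + ε) / ε) * (546 * (2 * Real.sqrt k)) := by gcongr
      _ = (1 + (2 + ε) / ε) * 1092 * Real.sqrt k := by ring
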